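/- Let $\{\zeta_j\}_{j\in\mathbb Z}$ be i.i.d. real random variables with $E\zeta_0=0$, $E\zeta_0^2=1$, $E\zeta_0^4<\infty$, and let $X_j=\sum_{k\ge 0}a_k\zeta_{j-k}$, $j\in\mathbb Z$ (convergence in mean square), where $a_k\in\mathbb R$ and $\sum_k a_k^2<\infty$. Let $f_X$ be the spectral density of $\{X_j\}$, i.e. $\operatorname{Cov}(X_{j+k},X_j)=\int_{-\pi}^{\pi}e^{iku}f_X(u)\,du$ for all $j,k\in\mathbb Z$, and let $A_X(u)=\sum_{k\ge0}e^{-iku}a_k$ (convergence in $L^2[-\pi,\pi]$) be the transfer function. Assume that for some $|d|<1/2$: (i) $f_X(u)=|u|^{-2d}g(u)$ for $0<|u|\le\pi$, where $g$ is continuous on $[-\pi,\pi]$ and $0<C_1\le g(u)\le C_2<\infty$ for all $u\in[-\pi,\pi]$; (ii) $A_X$ is differentiable on $(0,\pi)$ and, for some constant $C'$, $|\dot A_X(u)|\le C'u^{-1-d}$ for $u\in(0,\pi)$. For $n\ge1$ put $\nu=[n/2]-1$ and $u_j=2\pi j/n$, and for $Y=X$ or $Y=\zeta$ put $I_{Y,j}=(2\pi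 n)^{-1}\bigl|\sum_{k=1}^n e^{iu_jk}Y_k\bigr|^2$. For a triangular array of real weights $b_{n,j}$ define $$S_{n,X}=\sum_{j=1}^{\nu}b_{n,j}\frac{I_{X,j}}{f_X(u_j)},\qquad S_{n,\zeta}=\sum_{j=1}^{\nu}b_{n,j}\,2\pi I_{\zeta,j},\qquad R_n=S_{n,X}-S_{n,\zeta},$$ $$b_n=\max_{1\le j\le\nu}|b_{n,j}|,\qquad B_n=\Bigl(\sum_{j=1}^{\nu}b_{n,j}^2\Bigr)^{1/2}$$ (empty sums and maxima are $0$). Then there is a constant $C>0$, not depending on $n$ or on the weights, such that for every array $(b_{n,j})$ and every $n\ge1$ one has $ER_n^2<\infty$ and $$E(R_n-ER_n)^2\le C\,b_n^2\log^3 n,\qquad E(R_n-ER_n)^2\le C\,b_nB_n,\qquad |ER_n|\le C\,b_n\log^2 n,$$ $$E(S_{n,X}-S_{n,\zeta})^2\le C\,b_n^2\log^4 n.$$ Moreover, if $b_n=o(B_n)$ as $n\to\infty$, then $|ER_n|=o(B_n)$ and $E(S_{n,X}-S_{n,\zeta})^2=o(B_n^2)$. -/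

import Mathlib

open MeasureTheory ProbabilityTheory Filter Topology Asymptotics
open scoped Real

noncomputable section

namespace Bartlett

/-- The innovations: i.i.d. real random variables with mean zero and variance one. -/
structure IsIIDStandardized {Ω : Type*} [MeasurableSpace Ω] (P : Measure Ω)
    (ζ : ℤ → Ω → ℝ) : Prop where
  indep : iIndepFun ζ P
  identDistrib : ∀ j, IdentDistrib (ζ j) (ζ 0) P P
  memLp : MemLp (ζ 0) 2 P
  mean : ∫ ω, ζ 0 ω ∂P = 0
  variance : ∫ ω, (ζ 0 ω) ^ 2 ∂P = 1

/-- `X j = ∑_{k ≥ 0} a k * ζ (j - k)`, the series converging in mean square,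
where `∑ (a k)^2 < ∞`. -/
structure IsLinearProcess {Ω : Type*} [MeasurableSpace Ω] (P : Measure Ω)
    (a : ℕ → ℝ) (ζ X : ℤ → Ω → ℝ) : Prop where
  summable_sq : Summable fun k => (a k) ^ 2
  memLp : ∀ j, MemLp (X j) 2 P
  tendsto : ∀ j, Tendsto
    (fun N : ℕ => eLpNorm (fun ω => X j ω - ∑ k ∈ Finset.range N, a k * ζ (j - k) ω) 2 P)
    atTop (𝓝 0)

/-- `f` is (a version of) the spectral density of the stationary process `X`:
`Cov(X (j + k), X j) = ∫_{-π}^{π} e^{iku} f(u) du` for all integers `j`, `k`. -/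
structure IsSpectralDensity {Ω : Type*} [MeasurableSpace Ω] (P : Measure Ω)
    (X : ℤ → Ω → ℝ) (f : ℝ → ℝ) : Prop where
  nonneg : ∀ᵐ u ∂(volume.restrict (Set.Icc (-π) π)), 0 ≤ f u
  integrable : IntegrableOn f (Set.Icc (-π) π)
  cov_eq : ∀ j k : ℤ, ((cov[X (j + k), X j; P] : ℝ) : ℂ)
    = ∫ u in Set.Icc (-π) π, Complex.exp (Complex.I * k * u) * (f u : ℂ)

/-- `A` is (a version of) the transfer function `u ↦ ∑_{k ≥ 0} e^{-iku} a k` on `[-π, π]`,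
the series converging in `L²[-π, π]` (as it does for square summable `a`). -/
structure IsTransferFunction (a : ℕ → ℝ) (A : ℝ → ℂ) : Prop where
  memLp : MemLp A 2 (volume.restrict (Set.Icc (-π) π))
  tendsto : Tendsto
    (fun N : ℕ => eLpNorm
      (fun u : ℝ => A u - ∑ k ∈ Finset.range N, Complex.exp (-(Complex.I * k * u)) * (a k : ℂ))
      2 (volume.restrict (Set.Icc (-π) π)))
    atTop (𝓝 0)

/-- `f(u) = |u|^{-2d} g(u)` on `[-π, π]` (away from the possible singularity at `0`), with `g`
continuous on `[-π, π]` and bounded between two positive constants. -/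
def SpectralCondition (f : ℝ → ℝ) (d : ℝ) : Prop :=
  ∃ g : ℝ → ℝ, ContinuousOn g (Set.Icc (-π) π) ∧
    (∃ C₁ C₂ : ℝ, 0 < C₁ ∧ ∀ u ∈ Set.Icc (-π) π, C₁ ≤ g u ∧ g u ≤ C₂) ∧
    ∀ u ∈ Set.Icc (-π) π, u ≠ 0 → f u = |u| ^ (-(2 * d)) * g u

/-- `A` is differentiable on `(0, π)` and its derivative is `O(u^{-1-d})` there. (On `(-π, 0)`
this carries over by `A(-u) = conj (A u)`.) -/
def TransferCondition (A : ℝ → ℂ) (d : ℝ) : Prop :=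
  DifferentiableOn ℝ A (Set.Ioo 0 π) ∧
    ∃ C : ℝ, ∀ u ∈ Set.Ioo 0 π, ‖deriv A u‖ ≤ C * u ^ (-1 - d)

/-- The Fourier frequency `u_j = 2πj/n`. -/
def freq (n j : ℕ) : ℝ := 2 * π * j / n

/-- The discrete Fourier transform of `Y 1, …, Y n` at the frequency `u_j`. -/
def dft {Ω : Type*} (Y : ℤ → Ω → ℝ) (n j : ℕ) (ω : Ω) : ℂ :=
  ((1 / √(2 * π * n) : ℝ) : ℂ) *
    ∑ k ∈ Finset.Icc 1 n, Complex.exp (Complex.I * freq n j * k) * (Y k ω : ℂ)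

/-- The periodogram `I_{Y,j}` of `Y 1, …, Y n` at the frequency `u_j`. -/
def periodogram {Ω : Type*} (Y : ℤ → Ω → ℝ) (n j : ℕ) (ω : Ω) : ℝ :=
  ‖dft Y n j ω‖ ^ 2

/-- `ν = [n/2] - 1`; all sums over `j = 1, …, ν` are empty when `n < 4`. -/
def nu (n : ℕ) : ℕ := n / 2 - 1

/-- `S_{n,X} = ∑_{j=1}^ν b_{n,j} I_{X,j} / f_X(u_j)`. -/
def SX {Ω : Type*} (b : ℕ → ℕ → ℝ) (f : ℝ → ℝ) (X : ℤ → Ω → ℝ) (n : ℕ) (ω : Ω) : ℝ :=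
  ∑ j ∈ Finset.Icc 1 (nu n), b n j * (periodogram X n j ω / f (freq n j))

/-- `S_{n,ζ} = ∑_{j=1}^ν b_{n,j} 2π I_{ζ,j}`. -/
def Sζ {Ω : Type*} (b : ℕ → ℕ → ℝ) (ζ : ℤ → Ω → ℝ) (n : ℕ) (ω : Ω) : ℝ :=
  ∑ j ∈ Finset.Icc 1 (nu n), b n j * (2 * π * periodogram ζ n j ω)

/-- The approximation error `R_n = S_{n,X} - S_{n,ζ}`. -/
def R {Ω : Type*} (b : ℕ → ℕ → ℝ) (f : ℝ → ℝ) (X ζ : ℤ → Ω → ℝ) (n : ℕ) (ω : Ω) : ℝ :=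
  SX b f X n ω - Sζ b ζ n ω

/-- `b_n = max_{1 ≤ j ≤ ν} |b_{n,j}|` (zero if `ν < 1`). -/
def bmax (b : ℕ → ℕ → ℝ) (n : ℕ) : ℝ :=
  (((Finset.Icc 1 (nu n)).sup fun j => ‖b n j‖₊ : NNReal) : ℝ)

/-- `B_n = (∑_{j=1}^ν b_{n,j}^2)^{1/2}`. -/
def bnorm (b : ℕ → ℕ → ℝ) (n : ℕ) : ℝ :=
  √(∑ j ∈ Finset.Icc 1 (nu n), (b n j) ^ 2)

end Bartlett

end

/-! Everything happens in the space of coefficients with respect to the innovations. The normalized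
Fourier transform of `ζ` at `u_j` is a linear form in `ζ` with coefficient vector `e_j`, and these
vectors are orthonormal. Since `2π f = |A|²`, the transform of `X` divided by the conjugate of
`A(u_j)` is a linear form with vector `e_j + δ_j`. The symbol of `δ_j` is the Dirichlet kernel
centred at `u_j` times the conjugate of the relative error `A(u)/A(u_j) - 1`. So `R_n` is a
quadratic form in independent variables, with matrix `∑ b_j ((e_j + δ_j)(e_j + δ_j)* - e_j e_j*)` up
to taking real parts.

Its mean is the trace, `∑ b_j (2 Re⟨δ_j, e_j⟩ + ‖δ_j‖²)`. Its variance is at most a constant times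
the squared Frobenius norm (`StandardizedFourth.quadForm_bound`). Orthonormality of the `e_j` bounds
that norm by `6 ∑ b_j² ‖δ_j‖² + 3 (∑ |b_j| ‖δ_j‖²)²` (`OrthonormalOn.frobenius_le`), so covariances
between pairs of frequencies never have to be estimated.

By Parseval `‖δ_j‖²` and `⟨δ_j, e_j⟩` are the integrals `sqErr` and `meanErr`.
`TransferBounds.exists_err_le` bounds them by `1/j + 1/([n/2]-j)` and `(1 + log j)/j + 1/([n/2]-j)`.
Near `u_j` the derivative bound makes the relative error `O(|u - u_j|/u_j)`; elsewhere power bounds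
and kernel decay suffice. The term in `[n/2]-j` comes from the periodic copy of the kernel's peak
just left of `-π`.

Bounding the weights by `b_n` gives the logarithmic estimates. A Hölder argument
(`exists_weight_sum_bound`) gives `(∑ |b_j| (…))² ≤ C b_n B_n`, hence the other variance bound and
the `o(B_n)` statements. The vectors are finitely supported only for a truncated filter;
`IsLinearProcess.R_bound` removes the truncation. -/

namespace Bartlett

/-! ### Variance of quadratic forms in independent variables -/

section QuadraticForm

/-- The quadratic form `∑_{p, q ∈ S} M p q z_p z_q`. -/
def quadForm {Ω ι : Type*} (M : ι → ι → ℝ) (S : Finset ι) (z : ι → Ω → ℝ) (ω : Ω) :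
    ℝ :=
  ∑ p ∈ S, ∑ q ∈ S, M p q * (z p ω * z q ω)

/-- Isolates the new variable: the form becomes a quadratic polynomial in `z s` whose coefficients
depend only on the variables indexed by `S`. -/
theorem quadForm_insert {Ω ι : Type*} [DecidableEq ι] {z : ι → Ω → ℝ} (M : ι → ι → ℝ)
    {S : Finset ι} {s : ι} (hs : s ∉ S) (ω : Ω) :
    quadForm M (insert s S) z ω = quadForm M S z ω + M s s * z s ω ^ 2
      + (∑ q ∈ S, (M s q + M q s) * z q ω) * z s ω := by
  unfold quadForm
  simp only [Finset.sum_insert hs, Finset.sum_add_distrib, add_mul, Finset.sum_mul]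
  have h1 : ∑ x ∈ S, M x s * (z x ω * z s ω) = ∑ x ∈ S, M x s * z x ω * z s ω :=
    Finset.sum_congr rfl fun _ _ => by ring
  have h2 : ∑ x ∈ S, M s x * (z s ω * z x ω) = ∑ x ∈ S, M s x * z x ω * z s ω :=
    Finset.sum_congr rfl fun _ _ => by ring
  rw [h1, h2]; ring

variable {Ω ι : Type*} [MeasurableSpace Ω] {P : Measure Ω} {z : ι → Ω → ℝ}

/-- Independent random variables with mean zero, variance one and fourth moments at most `m`. -/
structure StandardizedFourth (P : Measure Ω) (z : ι → Ω → ℝ) (m : ℝ) : Prop where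
  indep : iIndepFun z P
  memLp : ∀ i, MemLp (z i) 4 P
  mean : ∀ i, ∫ ω, z i ω ∂P = 0
  variance : ∀ i, ∫ ω, (z i ω) ^ 2 ∂P = 1
  fourth : ∀ i, ∫ ω, (z i ω) ^ 4 ∂P ≤ m

theorem memLp_sq_of_memLp_four {x : Ω → ℝ} (h : MemLp x 4 P) :
    MemLp (fun ω => x ω ^ 2) 2 P := by
  have h2 : MemLp (fun ω => x ω * x ω) 2 P := by
    have : ENNReal.HolderTriple 4 4 2 := ⟨by
      have h4 : (4 : ENNReal) = 2 * 2 := by norm_num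
      rw [h4, ENNReal.mul_inv (by simp) (by simp), ← mul_add, ENNReal.inv_two_add_inv_two,
        mul_one]⟩
    exact h.mul h
  simpa [sq] using h2

variable {m : ℝ}

theorem StandardizedFourth.memLp_two [IsProbabilityMeasure P] (h : StandardizedFourth P z m) (i : ι) :
    MemLp (z i) 2 P :=
  (h.memLp i).mono_exponent (by norm_num)

/-- Lets an expectation of (polynomial in the old variables) times (function of the new one) factor;
all cross terms of the variance induction vanish this way. -/
theorem StandardizedFourth.indep_tuple (h : StandardizedFourth P z m) {S : Finset ι} {s : ι}
    (hs : s ∉ S) {φ : (S → ℝ) → ℝ} {ψ : ℝ → ℝ} (hφ : Measurable φ) (hψ : Measurable ψ) :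
    IndepFun (fun ω => φ fun i => z i ω) (fun ω => ψ (z s ω)) P := by
  classical
  have h1 := h.indep.indepFun_finset₀ S {s} (by simpa using hs)
    (fun i => (h.memLp i).aestronglyMeasurable.aemeasurable)
  exact h1.comp hφ (φ := φ)
    (ψ := fun x : (({s} : Finset ι) → ℝ) => ψ (x ⟨s, by simp⟩))
    (hψ.comp (measurable_pi_apply _))

/-- Mean and variance bound of a quadratic form in independent standardized variables. -/
theorem StandardizedFourth.quadForm_bound [IsProbabilityMeasure P]
    (h : StandardizedFourth P z m) (S : Finset ι) :
    ∀ M : ι → ι → ℝ, MemLp (quadForm M S z) 2 P ∧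
      ∫ ω, quadForm M S z ω ∂P = ∑ p ∈ S, M p p ∧
      ∫ ω, (quadForm M S z ω - ∑ p ∈ S, M p p) ^ 2 ∂P
        ≤ (m + 2) * ∑ p ∈ S, ∑ q ∈ S, M p q ^ 2 := by
  classical
  -- A new index `s` adds a diagonal part `V` and a part `W = L z_s` with `L` linear in the old
  -- variables. The centred parts `U`, `V`, `W` are pairwise orthogonal, so their second moments
  -- add. The claim is kept for all `M` because the hypothesis is also applied to the rank one
  -- matrix `l p * l q` to compute the second moment of `L`.
  induction S using Finset.induction_on with
  | empty =>
    intro M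
    have : quadForm M ∅ z = fun _ => 0 := by ext ω; simp [quadForm]
    simp [this]
  | insert s S hs ih =>
    intro M
    obtain ⟨hU2, hUint, hUvar⟩ := ih M
    set c : ℝ := ∑ p ∈ S, M p p with hc
    set l : ι → ℝ := fun q => M s q + M q s with hl
    set L : Ω → ℝ := fun ω => ∑ q ∈ S, l q * z q ω with hL
    have hm : 0 ≤ m := le_trans (integral_nonneg fun ω => by positivity) (h.fourth s)
    -- the linear part
    have hLL : ∀ ω, L ω ^ 2 = quadForm (fun p q => l p * l q) S z ω := by
      intro ω
      simp only [hL, quadForm, sq, Finset.sum_mul_sum]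
      exact Finset.sum_congr rfl fun _ _ => Finset.sum_congr rfl fun _ _ => by ring
    have hL2 : MemLp L 2 P :=
      memLp_finsetSum S fun q _ => (h.memLp_two q).const_mul (l q)
    have hLsq : ∫ ω, L ω ^ 2 ∂P = ∑ q ∈ S, l q ^ 2 := by
      simp_rw [hLL, (ih _).2.1, sq]
    have hLmean : ∫ ω, L ω ∂P = 0 := by
      simp only [hL]
      rw [integral_finsetSum _ fun q _ => ((h.memLp_two q).const_mul (l q)).integrable one_le_two]
      simp [integral_const_mul, h.mean]
    -- the three centred parts
    set U : Ω → ℝ := fun ω => quadForm M S z ω - c with hU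
    set V : Ω → ℝ := fun ω => M s s * (z s ω ^ 2 - 1) with hV
    set W : Ω → ℝ := fun ω => L ω * z s ω with hW
    have hU2' : MemLp U 2 P := hU2.sub (memLp_const c)
    have hz2 : MemLp (fun ω => z s ω ^ 2) 2 P := memLp_sq_of_memLp_four (h.memLp s)
    have hV2 : MemLp V 2 P := (hz2.sub (memLp_const 1)).const_mul _
    have hdec : ∀ ω, quadForm M (insert s S) z ω - ∑ p ∈ insert s S, M p p
        = U ω + V ω + W ω := by
      intro ω
      rw [quadForm_insert M hs, Finset.sum_insert hs]
      simp only [hU, hV, hW, hL, hl, hc]; ring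
    have hQeq : ∀ ω, quadForm M S z ω =
        ∑ p : S, ∑ q : S, M p q * (z p ω * z q ω) := by
      intro ω
      unfold quadForm
      rw [← Finset.sum_coe_sort S]
      exact Finset.sum_congr rfl fun p _ => by rw [← Finset.sum_coe_sort S]
    have hLeq : ∀ ω, L ω = ∑ q : S, l q * z q ω := by
      intro ω
      simp only [hL]
      rw [← Finset.sum_coe_sort S]
    -- With `k = 0`, the exponents `(1,0)`, `(1,1)`, `(0,1)`, `(0,2)` give `U`, `U L`, `L`, `L²`,
    -- all independent of any function of `z s`.
    have indUL : ∀ {ψ : ℝ → ℝ} (k : ℝ) (i j : ℕ), Measurable ψ →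
        IndepFun (fun ω => (k + U ω) ^ i * L ω ^ j) (fun ω => ψ (z s ω)) P := by
      intro ψ k i j hψ
      have := h.indep_tuple hs (φ := fun x : S → ℝ =>
        (k + ((∑ p : S, ∑ q : S, M p q * (x p * x q)) - c)) ^ i * (∑ q : S, l q * x q) ^ j)
        (by fun_prop) hψ
      simpa only [hU, hQeq, hLeq] using this
    have hUae : AEStronglyMeasurable U P := hU2'.aestronglyMeasurable
    have hLae : AEStronglyMeasurable L P := hL2.aestronglyMeasurable
    have hzae : AEStronglyMeasurable (z s) P := (h.memLp s).aestronglyMeasurable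
    have hVmean : ∫ ω, V ω ∂P = 0 := by
      simp only [hV]
      rw [integral_const_mul, integral_sub (hz2.integrable one_le_two) (integrable_const _)]
      simp [h.variance]
    have hUmean : ∫ ω, U ω ∂P = 0 := by
      simp only [hU]
      rw [integral_sub (hU2.integrable one_le_two) (integrable_const _), hUint]
      simp
    have hUV : ∫ ω, U ω * V ω ∂P = 0 := by
      have h1 := (indUL (ψ := fun x => M s s * (x ^ 2 - 1)) 0 1 0
        (by fun_prop)).integral_fun_mul_eq_mul_integral
        (by simpa using hUae) (by simpa [hV] using hV2.aestronglyMeasurable)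
      simp only [zero_add, pow_one, pow_zero, mul_one] at h1
      simpa [hUmean, hV] using h1
    have hUW : ∫ ω, U ω * W ω ∂P = 0 := by
      have h1 := (indUL (ψ := fun x => x) 0 1 1 measurable_id).integral_fun_mul_eq_mul_integral
        (by simpa [Pi.mul_def] using hUae.mul hLae) hzae
      simp only [zero_add, pow_one, h.mean, mul_zero] at h1
      simpa [hW, mul_assoc] using h1
    have hVW : ∫ ω, V ω * W ω ∂P = 0 := by
      have h1 := (indUL (ψ := fun x => M s s * (x ^ 2 - 1) * x) 0 0 1
        (by fun_prop)).integral_fun_mul_eq_mul_integral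
        (by simpa using hLae) (by
          simpa [hV, Pi.mul_def] using hV2.aestronglyMeasurable.mul hzae)
      simp only [pow_zero, pow_one, one_mul, hLmean, zero_mul] at h1
      rw [← h1]
      exact integral_congr_ae (ae_of_all _ fun ω => by simp only [hV, hW]; ring)
    have indL2 := indUL (ψ := fun x => x ^ 2) 0 0 2 (by fun_prop)
    have hW2eq : ∀ ω, W ω ^ 2 = ((0 + U ω) ^ 0 * L ω ^ 2) * z s ω ^ 2 := by
      intro ω; simp only [hW]; ring
    have hWsq : ∫ ω, W ω ^ 2 ∂P = ∑ q ∈ S, l q ^ 2 := by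
      simp_rw [hW2eq]
      rw [indL2.integral_fun_mul_eq_mul_integral (by simpa [Pi.pow_def] using hLae.pow 2)
        (by simpa [Pi.pow_def] using hzae.pow 2)]
      simp [h.variance, hLsq]
    -- Independence makes `L² z_s²` integrable from the integrability of each factor; no fourth
    -- moment of `L` is needed.
    have hW2 : MemLp W 2 P := by
      refine (memLp_two_iff_integrable_sq (hLae.mul hzae)).2 ?_
      have := indL2.integrable_mul (by simpa using hL2.integrable_sq) (hz2.integrable one_le_two)
      refine this.congr (ae_of_all _ fun ω => ?_)
      simp only [Pi.mul_apply]; ring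
    have hVsq : ∫ ω, V ω ^ 2 ∂P ≤ (m + 2) * M s s ^ 2 := by
      have h4 : Integrable (fun ω => z s ω ^ 4) P := by
        refine hz2.integrable_sq.congr (ae_of_all _ fun ω => ?_)
        simp only []; ring
      have h5 : ∫ ω, V ω ^ 2 ∂P = M s s ^ 2 * (∫ ω, z s ω ^ 4 ∂P - 1) := by
        have : ∀ ω, V ω ^ 2 = M s s ^ 2 * ((z s ω ^ 4 - 2 * z s ω ^ 2) + 1) := by
          intro ω; simp only [hV]; ring
        simp_rw [this]
        have h6 : Integrable (fun ω => z s ω ^ 4 - 2 * z s ω ^ 2) P :=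
          h4.sub ((hz2.integrable one_le_two).const_mul 2)
        rw [integral_const_mul, integral_add h6 (integrable_const _), integral_sub h4 ((hz2.integrable one_le_two).const_mul 2),
          integral_const_mul, h.variance]
        simp; left; ring
      rw [h5]
      have := h.fourth s
      nlinarith [sq_nonneg (M s s)]
    -- The constant `m + 2` covers both parts: `m` for the diagonal, and the `2` of `(x + y)² ≤ 2x²
    -- + 2y²` here.
    have hlsq : ∑ q ∈ S, l q ^ 2 ≤ (m + 2) * ∑ q ∈ S, (M s q ^ 2 + M q s ^ 2) := by
      rw [Finset.mul_sum]
      refine Finset.sum_le_sum fun q _ => ?_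
      simp only [hl]
      nlinarith [sq_nonneg (M s q - M q s), sq_nonneg (M s q), sq_nonneg (M q s)]
    have hT2 : MemLp (fun ω => U ω + V ω + W ω) 2 P := (hU2'.add hV2).add hW2
    refine ⟨?_, ?_, ?_⟩
    · have : quadForm M (insert s S) z = fun ω => (U ω + V ω + W ω) + ∑ p ∈ insert s S, M p p := by
        ext ω; rw [← hdec]; ring
      rw [this]; exact hT2.add (memLp_const _)
    · have : ∀ ω, quadForm M (insert s S) z ω = ((U ω + V ω) + W ω) + ∑ p ∈ insert s S, M p p := by
        intro ω; rw [← hdec]; ring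
      have hWmean : ∫ ω, W ω ∂P = 0 := by
        have h1 := (indUL (ψ := fun x => x) 0 0 1 measurable_id).integral_fun_mul_eq_mul_integral
          (by simpa using hLae) hzae
        simpa [h.mean] using h1
      have hUVi : Integrable (fun ω => U ω + V ω) P := (hU2'.add hV2).integrable one_le_two
      simp_rw [this]
      rw [integral_add (hT2.integrable one_le_two) (integrable_const _),
        integral_add hUVi (hW2.integrable one_le_two),
        integral_add (hU2'.integrable one_le_two) (hV2.integrable one_le_two),
        hUmean, hVmean, hWmean]
      simp
    · simp_rw [hdec]
      have hexp : ∀ ω, (U ω + V ω + W ω) ^ 2 = ((U ω ^ 2 + V ω ^ 2) + W ω ^ 2)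
          + ((2 * (U ω * V ω) + 2 * (U ω * W ω)) + 2 * (V ω * W ω)) := fun ω => by ring
      have iUV := (hU2'.integrable_mul hV2).const_mul 2
      have iUW := (hU2'.integrable_mul hW2).const_mul 2
      have iVW := (hV2.integrable_mul hW2).const_mul 2
      simp only [Pi.mul_apply] at iUV iUW iVW
      simp_rw [hexp]
      have i1 : Integrable (fun ω => U ω ^ 2 + V ω ^ 2) P :=
        hU2'.integrable_sq.add hV2.integrable_sq
      have i2 : Integrable (fun ω => U ω ^ 2 + V ω ^ 2 + W ω ^ 2) P := i1.add hW2.integrable_sq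
      have i3 : Integrable (fun ω => 2 * (U ω * V ω) + 2 * (U ω * W ω)) P := iUV.add iUW
      have i4 : Integrable (fun ω => 2 * (U ω * V ω) + 2 * (U ω * W ω) + 2 * (V ω * W ω)) P :=
        i3.add iVW
      rw [integral_add i2 i4, integral_add i1 hW2.integrable_sq,
        integral_add hU2'.integrable_sq hV2.integrable_sq, integral_add i3 iVW, integral_add iUV iUW,
        integral_const_mul, integral_const_mul, integral_const_mul, hUV, hUW, hVW, hWsq]
      have hsum : ∑ p ∈ insert s S, ∑ q ∈ insert s S, M p q ^ 2
          = ∑ p ∈ S, ∑ q ∈ S, M p q ^ 2 + M s s ^ 2 + ∑ q ∈ S, (M s q ^ 2 + M q s ^ 2) := by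
        simp only [Finset.sum_insert hs, Finset.sum_add_distrib]; ring
      rw [hsum, mul_add, mul_add]
      linarith

end QuadraticForm

/-! ### Frobenius norm of perturbed orthogonal projections -/

section Frobenius

open scoped ComplexConjugate

variable {ι J : Type*} {S : Finset ι} {T : Finset J} {e : J → ι → ℂ}

/-- The vectors `e j`, `j ∈ T`, are orthonormal in `ℂ^S`. -/
def OrthonormalOn [DecidableEq J] (S : Finset ι) (T : Finset J) (e : J → ι → ℂ) : Prop :=
  ∀ j ∈ T, ∀ k ∈ T, ∑ m ∈ S, e j m * conj (e k m) = if j = k then 1 else 0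

/-- Pythagoras. It removes the cross terms between different frequencies. -/
theorem OrthonormalOn.sum_norm_sq [DecidableEq J] (h : OrthonormalOn S T e) (x : J → ℂ) :
    ∑ m ∈ S, ‖∑ j ∈ T, x j * e j m‖ ^ 2 = ∑ j ∈ T, ‖x j‖ ^ 2 := by
  have key : ((∑ m ∈ S, ‖∑ j ∈ T, x j * e j m‖ ^ 2 : ℝ) : ℂ) = ((∑ j ∈ T, ‖x j‖ ^ 2 : ℝ) : ℂ) := by
    push_cast
    simp_rw [← Complex.mul_conj', map_sum, map_mul, Finset.sum_mul_sum]
    rw [Finset.sum_comm]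
    refine Finset.sum_congr rfl fun j hj => ?_
    rw [Finset.sum_comm]
    have : ∀ k ∈ T, ∑ m ∈ S, x j * e j m * (conj (x k) * conj (e k m))
        = if j = k then x j * conj (x k) else 0 := by
      intro k hk
      have h1 : ∀ m ∈ S, x j * e j m * (conj (x k) * conj (e k m))
          = x j * conj (x k) * (e j m * conj (e k m)) := fun m _ => by ring
      rw [Finset.sum_congr rfl h1, ← Finset.mul_sum, h j hj k hk]
      split_ifs <;> simp
    rw [Finset.sum_congr rfl this]
    simp [hj]
  exact_mod_cast key

/-- Cauchy–Schwarz with the weight split as `√|b| * √|b|`. The bound is a product of a function of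
`p` and one of `q`, so it can be summed; it handles the part quadratic in `δ`, where no
orthogonality is available. -/
theorem norm_sq_sum_mul_conj_le (b : J → ℝ) (δ : J → ι → ℂ) (p q : ι) :
    ‖∑ j ∈ T, (b j : ℂ) * (δ j p * conj (δ j q))‖ ^ 2
      ≤ (∑ j ∈ T, |b j| * ‖δ j p‖ ^ 2) * ∑ j ∈ T, |b j| * ‖δ j q‖ ^ 2 := by
  have h1 : ‖∑ j ∈ T, (b j : ℂ) * (δ j p * conj (δ j q))‖
      ≤ ∑ j ∈ T, (√|b j| * ‖δ j p‖) * (√|b j| * ‖δ j q‖) := by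
    refine (norm_sum_le _ _).trans (Finset.sum_le_sum fun j _ => ?_)
    simp only [norm_mul, RCLike.norm_conj, Complex.norm_real, Real.norm_eq_abs]
    have := Real.mul_self_sqrt (abs_nonneg (b j))
    refine le_of_eq ?_
    calc |b j| * (‖δ j p‖ * ‖δ j q‖) = (√|b j| * √|b j|) * (‖δ j p‖ * ‖δ j q‖) := by rw [this]
      _ = _ := by ring
  calc _ ≤ (∑ j ∈ T, (√|b j| * ‖δ j p‖) * (√|b j| * ‖δ j q‖)) ^ 2 := by gcongr
    _ ≤ (∑ j ∈ T, (√|b j| * ‖δ j p‖) ^ 2) * ∑ j ∈ T, (√|b j| * ‖δ j q‖) ^ 2 :=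
      Finset.sum_mul_sq_le_sq_mul_sq _ _ _
    _ = _ := by simp only [mul_pow, Real.sq_sqrt (abs_nonneg _)]

/-- Frobenius norm of a perturbation of a weighted sum of orthogonal rank one projections. -/
theorem OrthonormalOn.frobenius_le [DecidableEq J] (h : OrthonormalOn S T e) (b : J → ℝ)
    (δ : J → ι → ℂ) :
    ∑ p ∈ S, ∑ q ∈ S, ‖∑ j ∈ T, (b j : ℂ) *
        ((e j p + δ j p) * conj (e j q + δ j q) - e j p * conj (e j q))‖ ^ 2
      ≤ 6 * ∑ j ∈ T, b j ^ 2 * ∑ m ∈ S, ‖δ j m‖ ^ 2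
        + 3 * (∑ j ∈ T, |b j| * ∑ m ∈ S, ‖δ j m‖ ^ 2) ^ 2 := by
  -- The difference expands as `eδ* + δe* + δδ*`. The second part is the adjoint of the first and
  -- has the same Frobenius norm, which is why the final constant is `6 = 3 + 3`.
  set F₁ : ι → ι → ℂ := fun p q => ∑ j ∈ T, ((b j : ℂ) * conj (δ j q)) * e j p with hF₁
  set F₂ : ι → ι → ℂ := fun p q => ∑ j ∈ T, (b j : ℂ) * (δ j p * conj (δ j q)) with hF₂
  have hdec : ∀ p q, ∑ j ∈ T, (b j : ℂ) *
      ((e j p + δ j p) * conj (e j q + δ j q) - e j p * conj (e j q))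
      = F₁ p q + conj (F₁ q p) + F₂ p q := by
    intro p q
    simp only [hF₁, hF₂, map_sum, map_mul, Complex.conj_conj, Complex.conj_ofReal,
      ← Finset.sum_add_distrib]
    refine Finset.sum_congr rfl fun j _ => ?_
    simp only [map_add]; ring
  have hle : ∀ p q, ‖F₁ p q + conj (F₁ q p) + F₂ p q‖ ^ 2
      ≤ 3 * ‖F₁ p q‖ ^ 2 + 3 * ‖F₁ q p‖ ^ 2 + 3 * ‖F₂ p q‖ ^ 2 := by
    intro p q
    have h1 := norm_add₃_le (a := F₁ p q) (b := conj (F₁ q p)) (c := F₂ p q)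
    rw [RCLike.norm_conj] at h1
    have h2 := pow_le_pow_left₀ (norm_nonneg _) h1 2
    nlinarith [sq_nonneg (‖F₁ p q‖ - ‖F₁ q p‖), sq_nonneg (‖F₁ p q‖ - ‖F₂ p q‖),
      sq_nonneg (‖F₁ q p‖ - ‖F₂ p q‖)]
  have hF₁sum : ∑ q ∈ S, ∑ p ∈ S, ‖F₁ p q‖ ^ 2 = ∑ j ∈ T, b j ^ 2 * ∑ m ∈ S, ‖δ j m‖ ^ 2 := by
    simp only [hF₁]
    rw [Finset.sum_congr rfl fun q _ => h.sum_norm_sq fun j => (b j : ℂ) * conj (δ j q),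
      Finset.sum_comm]
    refine Finset.sum_congr rfl fun j _ => ?_
    rw [Finset.mul_sum]
    refine Finset.sum_congr rfl fun m _ => ?_
    simp [mul_pow]
  have hF₂sum : ∑ p ∈ S, ∑ q ∈ S, ‖F₂ p q‖ ^ 2 ≤ (∑ j ∈ T, |b j| * ∑ m ∈ S, ‖δ j m‖ ^ 2) ^ 2 := by
    calc _ ≤ ∑ p ∈ S, ∑ q ∈ S,
          (∑ j ∈ T, |b j| * ‖δ j p‖ ^ 2) * ∑ j ∈ T, |b j| * ‖δ j q‖ ^ 2 :=
        Finset.sum_le_sum fun p _ => Finset.sum_le_sum fun q _ =>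
          norm_sq_sum_mul_conj_le b δ p q
      _ = _ := by
        rw [← Finset.sum_mul_sum, ← sq, Finset.sum_comm]
        simp only [Finset.mul_sum]
  calc _ ≤ ∑ p ∈ S, ∑ q ∈ S, (3 * ‖F₁ p q‖ ^ 2 + 3 * ‖F₁ q p‖ ^ 2 + 3 * ‖F₂ p q‖ ^ 2) := by
        refine Finset.sum_le_sum fun p _ => Finset.sum_le_sum fun q _ => ?_
        rw [hdec]; exact hle p q
    _ = 3 * ∑ q ∈ S, ∑ p ∈ S, ‖F₁ p q‖ ^ 2 + 3 * ∑ q ∈ S, ∑ p ∈ S, ‖F₁ p q‖ ^ 2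
        + 3 * ∑ p ∈ S, ∑ q ∈ S, ‖F₂ p q‖ ^ 2 := by
        simp only [Finset.sum_add_distrib, ← Finset.mul_sum]
        rw [Finset.sum_comm (f := fun p q => ‖F₁ p q‖ ^ 2)]
    _ ≤ _ := by rw [hF₁sum]; linarith

end Frobenius

/-! ### Trigonometric polynomials and Parseval's identity -/

section TrigPoly

open scoped ComplexConjugate

/-- The trigonometric polynomial `∑ p_m e^{-imu}`. -/
noncomputable def trig (u : ℝ) : (ℤ →₀ ℂ) →ₗ[ℂ] ℂ :=
  Finsupp.linearCombination ℂ fun m : ℤ => Complex.exp (-(Complex.I * m * u))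

theorem trig_single (u : ℝ) (m : ℤ) (c : ℂ) :
    trig u (Finsupp.single m c) = c * Complex.exp (-(Complex.I * m * u)) := by
  simp [trig]

theorem trig_eq_sum (u : ℝ) {p : ℤ →₀ ℂ} {S : Finset ℤ} (h : p.support ⊆ S) :
    trig u p = ∑ m ∈ S, p m * Complex.exp (-(Complex.I * m * u)) := by
  rw [trig, Finsupp.linearCombination_apply, Finsupp.sum_of_support_subset _ h]
  · simp
  · simp

theorem integral_exp_int (k : ℤ) :
    ∫ u in Set.Icc (-π) π, Complex.exp (Complex.I * k * u) = if k = 0 then (2 * π : ℂ) else 0 := by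
  rw [integral_Icc_eq_integral_Ioc, ← intervalIntegral.integral_of_le (by linarith [Real.pi_pos])]
  split_ifs with hk
  · simp [hk]; ring
  · have hc : Complex.I * (k : ℂ) ≠ 0 := mul_ne_zero Complex.I_ne_zero (by exact_mod_cast hk)
    rw [integral_exp_mul_complex hc]
    have : Complex.exp (Complex.I * k * (π : ℝ)) = Complex.exp (Complex.I * k * ((-π : ℝ) : ℂ)) := by
      rw [Complex.exp_eq_exp_iff_exists_int]
      exact ⟨k, by push_cast; ring⟩
    rw [this]; simp

/-- Parseval's identity for trigonometric polynomials. -/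
theorem sum_mul_conj_eq_integral {p q : ℤ →₀ ℂ} {S : Finset ℤ} (hp : p.support ⊆ S)
    (hq : q.support ⊆ S) :
    ∑ m ∈ S, p m * conj (q m)
      = (2 * π : ℂ)⁻¹ * ∫ u in Set.Icc (-π) π, trig u p * conj (trig u q) := by
  have hint : ∀ m k : ℤ, IntegrableOn
      (fun u : ℝ => p m * conj (q k) * Complex.exp (Complex.I * ((k - m : ℤ) : ℂ) * u))
      (Set.Icc (-π) π) := fun m k => by
    refine ContinuousOn.integrableOn_Icc ?_
    fun_prop
  have h1 : ∀ u : ℝ, trig u p * conj (trig u q) = ∑ m ∈ S, ∑ k ∈ S,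
      p m * conj (q k) * Complex.exp (Complex.I * ((k - m : ℤ) : ℂ) * u) := by
    intro u
    rw [trig_eq_sum u hp, trig_eq_sum u hq, map_sum, Finset.sum_mul_sum]
    refine Finset.sum_congr rfl fun m _ => Finset.sum_congr rfl fun k _ => ?_
    rw [map_mul, ← Complex.exp_conj]
    simp only [map_neg, map_mul, Complex.conj_I, Complex.conj_ofReal, map_intCast]
    rw [mul_mul_mul_comm, ← Complex.exp_add]
    congr 2
    push_cast; ring
  simp_rw [h1]
  rw [integral_finsetSum _ fun m _ => integrable_finsetSum _ fun k _ => hint m k, Finset.mul_sum]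
  refine Finset.sum_congr rfl fun m hm => ?_
  rw [integral_finsetSum _ fun k _ => hint m k]
  have h2 : ∀ k ∈ S, ∫ u in Set.Icc (-π) π,
      p m * conj (q k) * Complex.exp (Complex.I * ((k - m : ℤ) : ℂ) * u)
      = if m = k then p m * conj (q k) * (2 * π) else 0 := by
    intro k _
    rw [integral_const_mul, integral_exp_int]
    by_cases h : m = k
    · simp [h]
    · have : k - m ≠ 0 := fun h' => h (by omega)
      simp [h, this]
  rw [Finset.sum_congr rfl h2]
  have : (π : ℂ) ≠ 0 := by exact_mod_cast Real.pi_ne_zero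
  simp only [Finset.sum_ite_eq, hm, if_true]
  field_simp

end TrigPoly

/-! ### Coefficient vectors of the discrete Fourier transforms -/

section Vectors

open scoped ComplexConjugate

/-- The Dirichlet type kernel `∑_{t=1}^n e^{it(u_j - u)}`. -/
noncomputable def kern (n j : ℕ) (u : ℝ) : ℂ :=
  ∑ t ∈ Finset.Icc 1 n, Complex.exp (Complex.I * freq n j * t) * Complex.exp (-(Complex.I * t * u))

/-- Partial sums of the transfer function. -/
noncomputable def partialTransfer (a : ℕ → ℝ) (N : ℕ) (u : ℝ) : ℂ :=
  ∑ k ∈ Finset.range N, Complex.exp (-(Complex.I * k * u)) * (a k : ℂ)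

/-- Partial sums of the linear process. -/
def partialProcess {Ω : Type*} (a : ℕ → ℝ) (ζ : ℤ → Ω → ℝ) (N : ℕ) (t : ℤ) (ω : Ω) : ℝ :=
  ∑ k ∈ Finset.range N, a k * ζ (t - k) ω

/-- Coefficients, with respect to the innovations, of the normalized discrete Fourier transform
of the innovations. -/
noncomputable def innovationVec (n j : ℕ) : ℤ →₀ ℂ :=
  ((1 / √n : ℝ) : ℂ) • ∑ t ∈ Finset.Icc 1 n,
    Finsupp.single (t : ℤ) (Complex.exp (Complex.I * freq n j * t))

/-- Coefficients, with respect to the innovations, of the discrete Fourier transform of the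
truncated linear process, divided by the conjugate of `α`. -/
noncomputable def processVec (a : ℕ → ℝ) (α : ℂ) (n N j : ℕ) : ℤ →₀ ℂ :=
  (((1 / √n : ℝ) : ℂ) * (conj α)⁻¹) • ∑ t ∈ Finset.Icc 1 n, ∑ k ∈ Finset.range N,
    Finsupp.single ((t : ℤ) - k) (Complex.exp (Complex.I * freq n j * t) * a k)

theorem trig_innovationVec (n j : ℕ) (u : ℝ) :
    trig u (innovationVec n j) = ((1 / √n : ℝ) : ℂ) * kern n j u := by
  simp only [innovationVec, map_smul, map_sum, trig_single, smul_eq_mul, kern, Int.cast_natCast]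

/-- Filtering acts on symbols as multiplication. The conjugate appears because the shift by `-k`
contributes `exp(iku)`; this is why the vector was divided by the conjugate of `α`. -/
theorem trig_processVec (a : ℕ → ℝ) (α : ℂ) (n N j : ℕ) (u : ℝ) :
    trig u (processVec a α n N j) =
      ((1 / √n : ℝ) : ℂ) * kern n j u * conj (partialTransfer a N u / α) := by
  simp only [processVec, map_smul, map_sum, trig_single, smul_eq_mul, kern, map_div₀,
    partialTransfer, map_mul, Complex.conj_ofReal]
  rw [mul_assoc, mul_assoc, div_eq_inv_mul _ (conj α), mul_left_comm (∑ t ∈ _, _), Finset.sum_mul_sum]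
  congr 2
  refine Finset.sum_congr rfl fun t _ => Finset.sum_congr rfl fun k _ => ?_
  rw [← Complex.exp_conj]
  simp only [map_neg, map_mul, Complex.conj_I, Complex.conj_ofReal, map_natCast]
  have : Complex.exp (-(Complex.I * (((t : ℤ) - (k : ℤ) : ℤ) : ℂ) * u))
      = Complex.exp (-(Complex.I * t * u)) * Complex.exp (-(-Complex.I * k * u)) := by
    rw [← Complex.exp_add]; congr 1; push_cast; ring
  rw [this]; ring

theorem support_innovationVec (n j N : ℕ) :
    (innovationVec n j).support ⊆ Finset.Icc (-(N : ℤ)) n := by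
  have : innovationVec n j ∈ Finsupp.supported ℂ ℂ (Finset.Icc (-(N : ℤ)) n : Set ℤ) := by
    refine Submodule.smul_mem _ _ (Submodule.sum_mem _ fun t ht => ?_)
    refine Finsupp.single_mem_supported _ _ ?_
    simp only [Finset.mem_Icc, Finset.coe_Icc, Set.mem_Icc] at ht ⊢
    omega
  exact_mod_cast (Finsupp.mem_supported _ _).1 this

theorem support_processVec (a : ℕ → ℝ) (α : ℂ) (n N j : ℕ) :
    (processVec a α n N j).support ⊆ Finset.Icc (-(N : ℤ)) n := by
  have : processVec a α n N j ∈ Finsupp.supported ℂ ℂ (Finset.Icc (-(N : ℤ)) n : Set ℤ) := by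
    refine Submodule.smul_mem _ _ (Submodule.sum_mem _ fun t ht =>
      Submodule.sum_mem _ fun k hk => ?_)
    refine Finsupp.single_mem_supported _ _ ?_
    simp only [Finset.mem_Icc, Finset.coe_Icc, Set.mem_Icc, Finset.mem_range] at ht hk ⊢
    omega
  exact_mod_cast (Finsupp.mem_supported _ _).1 this

/-- A geometric sum whose ratio is an `n`-th root of unity, different from `1` when `j ≠ k` because
`|j - k| < n`. -/
theorem sum_exp_freq_sub {n j k : ℕ} (hj : j < n) (hk : k < n) :
    ∑ t ∈ Finset.Icc 1 n, Complex.exp (Complex.I * freq n j * t) *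
      conj (Complex.exp (Complex.I * freq n k * t)) = if j = k then (n : ℂ) else 0 := by
  have hn : (n : ℂ) ≠ 0 := by exact_mod_cast (by omega : n ≠ 0)
  set r : ℂ := Complex.exp (Complex.I * (freq n j - freq n k)) with hr
  have h1 : ∀ t : ℕ, Complex.exp (Complex.I * freq n j * t) *
      conj (Complex.exp (Complex.I * freq n k * t)) = r ^ t := by
    intro t
    rw [← Complex.exp_conj, ← Complex.exp_add, hr, ← Complex.exp_nat_mul]
    congr 1
    simp only [map_mul, Complex.conj_I, Complex.conj_ofReal, map_natCast]; ring
  simp_rw [h1]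
  split_ifs with hjk
  · subst hjk; simp [hr]
  · have hrn : r ^ n = 1 := by
      rw [hr, ← Complex.exp_nat_mul, Complex.exp_eq_one_iff]
      refine ⟨(j : ℤ) - k, ?_⟩
      simp only [freq]; push_cast; field_simp
    have hr1 : r ≠ 1 := by
      rw [hr, Ne, Complex.exp_eq_one_iff]
      rintro ⟨m, hm⟩
      simp only [freq] at hm
      push_cast at hm
      have hpi : (π : ℂ) ≠ 0 := by exact_mod_cast Real.pi_ne_zero
      have h2 : ((j : ℂ) - k) = m * n := by
        have h3 : 2 * π * Complex.I * ((j : ℂ) - k) = 2 * π * Complex.I * (m * n) := by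
          field_simp at hm
          linear_combination (2 * π * Complex.I) * hm
        exact mul_left_cancel₀ Complex.two_pi_I_ne_zero h3
      have h3 : (j : ℤ) - k = m * n := by exact_mod_cast h2
      have h4 : m = 0 := by
        by_contra hm0
        have h5 : (n : ℤ) ≤ |(j : ℤ) - k| := by
          rw [h3, abs_mul, Nat.abs_cast]
          have := Int.one_le_abs hm0
          nlinarith
        have h6 : |(j : ℤ) - k| < n := abs_lt.2 ⟨by omega, by omega⟩
        omega
      rw [h4] at h3
      omega
    rw [← Finset.Ico_add_one_right_eq_Icc, Finset.sum_Ico_eq_sum_range]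
    simp_rw [pow_add]
    rw [← Finset.mul_sum, Nat.add_sub_cancel, geom_sum_eq hr1, hrn]
    simp

theorem innovationVec_apply (n j : ℕ) (m : ℤ) :
    innovationVec n j m = ∑ t ∈ Finset.Icc 1 n, if (t : ℤ) = m then
      ((1 / √n : ℝ) : ℂ) * Complex.exp (Complex.I * freq n j * t) else 0 := by
  simp only [innovationVec, Finsupp.smul_apply, Finsupp.finsetSum_apply, Finsupp.single_apply,
    smul_eq_mul, Finset.mul_sum, mul_ite, mul_zero]

theorem orthonormalOn_innovationVec {n N : ℕ} {T : Finset ℕ} (hT : ∀ j ∈ T, j < n) :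
    OrthonormalOn (Finset.Icc (-(N : ℤ)) n) T fun j => innovationVec n j := by
  intro j hj k hk
  have hn : 0 < n := by have := hT j hj; omega
  simp_rw [innovationVec_apply n k, map_sum, apply_ite conj, map_zero, Finset.mul_sum, mul_ite,
    mul_zero]
  rw [Finset.sum_comm]
  have h1 : ∀ t ∈ Finset.Icc 1 n, ∑ m ∈ Finset.Icc (-(N : ℤ)) n, (if (t : ℤ) = m then
      innovationVec n j m * conj (((1 / √n : ℝ) : ℂ) * Complex.exp (Complex.I * freq n k * t))
      else 0) = (n : ℂ)⁻¹ * (Complex.exp (Complex.I * freq n j * t) *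
      conj (Complex.exp (Complex.I * freq n k * t))) := by
    intro t ht
    have ht' : (t : ℤ) ∈ Finset.Icc (-(N : ℤ)) n := by
      simp only [Finset.mem_Icc] at ht ⊢; omega
    rw [Finset.sum_ite_eq, if_pos ht', innovationVec_apply]
    simp only [Nat.cast_inj, Finset.sum_ite_eq', ht, if_true, map_mul, Complex.conj_ofReal]
    have : ((1 / √n : ℝ) : ℂ) * ((1 / √n : ℝ) : ℂ) = (n : ℂ)⁻¹ := by
      rw [← Complex.ofReal_mul, div_mul_div_comm, Real.mul_self_sqrt (Nat.cast_nonneg _)]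
      simp
    rw [← this]; ring
  rw [Finset.sum_congr rfl h1, ← Finset.mul_sum, sum_exp_freq_sub (hT j hj) (hT k hk)]
  split_ifs
  · exact inv_mul_cancel₀ (by exact_mod_cast hn.ne')
  · simp

/-- `∑ p_m ζ_m`. -/
noncomputable def linForm {Ω : Type*} (ζ : ℤ → Ω → ℝ) (ω : Ω) : (ℤ →₀ ℂ) →ₗ[ℂ] ℂ :=
  Finsupp.linearCombination ℂ fun m : ℤ => (ζ m ω : ℂ)

theorem norm_sq_linForm {Ω : Type*} (ζ : ℤ → Ω → ℝ) (ω : Ω) {p : ℤ →₀ ℂ} {S : Finset ℤ}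
    (h : p.support ⊆ S) :
    ‖linForm ζ ω p‖ ^ 2 = ∑ l ∈ S, ∑ m ∈ S, (p l * conj (p m)).re * (ζ l ω * ζ m ω) := by
  have h1 : linForm ζ ω p = ∑ m ∈ S, p m * (ζ m ω : ℂ) := by
    rw [linForm, Finsupp.linearCombination_apply, Finsupp.sum_of_support_subset _ h] <;> simp
  have h2 : ‖linForm ζ ω p‖ ^ 2 = (linForm ζ ω p * conj (linForm ζ ω p)).re := by
    rw [Complex.mul_conj', ← Complex.ofReal_pow, Complex.ofReal_re]
  rw [h2, h1, map_sum, Finset.sum_mul_sum]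
  simp only [Complex.re_sum, map_mul, Complex.conj_ofReal]
  refine Finset.sum_congr rfl fun l _ => Finset.sum_congr rfl fun m _ => ?_
  rw [mul_mul_mul_comm, ← Complex.ofReal_mul, Complex.re_mul_ofReal]

theorem two_pi_mul_periodogram {Ω : Type*} (ζ : ℤ → Ω → ℝ) (n j : ℕ) (ω : Ω) :
    2 * π * periodogram ζ n j ω = ‖linForm ζ ω (innovationVec n j)‖ ^ 2 := by
  simp only [periodogram, dft, innovationVec, map_smul, map_sum, linForm,
    Finsupp.linearCombination_single, smul_eq_mul, norm_mul, mul_pow,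
    Complex.norm_real, norm_div, norm_one, Real.norm_eq_abs, abs_of_nonneg (Real.sqrt_nonneg _)]
  rw [← mul_assoc]
  congr 1
  rw [div_pow, div_pow, Real.sq_sqrt (by positivity), Real.sq_sqrt (by positivity)]
  have := Real.pi_pos
  field_simp

/-- Dividing the periodogram by the spectral density amounts to dividing the transform by the
transfer function, since the modulus does not see the phase. -/
theorem periodogram_partialProcess_div {Ω : Type*} (a : ℕ → ℝ) (ζ : ℤ → Ω → ℝ) (n N j : ℕ) (ω : Ω)
    {α : ℂ} {y : ℝ} (h : ‖α‖ ^ 2 = 2 * π * y) :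
    periodogram (partialProcess a ζ N) n j ω / y = ‖linForm ζ ω (processVec a α n N j)‖ ^ 2 := by
  have hsum : ∑ t ∈ Finset.Icc 1 n, Complex.exp (Complex.I * freq n j * t) *
        ((partialProcess a ζ N t ω : ℝ) : ℂ)
      = ∑ t ∈ Finset.Icc 1 n, ∑ k ∈ Finset.range N,
        Complex.exp (Complex.I * freq n j * t) * a k * (ζ (t - k) ω : ℂ) := by
    refine Finset.sum_congr rfl fun t _ => ?_
    simp only [partialProcess, Complex.ofReal_sum, Finset.mul_sum, Complex.ofReal_mul, mul_assoc]
  simp only [periodogram, dft, processVec, map_smul, map_sum, linForm, hsum,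
    Finsupp.linearCombination_single, smul_eq_mul, norm_mul, mul_pow, norm_inv, RCLike.norm_conj,
    Complex.norm_real, norm_div, norm_one, Real.norm_eq_abs, abs_of_nonneg (Real.sqrt_nonneg _)]
  rw [div_pow, div_pow, Real.sq_sqrt (by positivity), Real.sq_sqrt (by positivity), inv_pow, h]
  have := Real.pi_pos
  field_simp

end Vectors

/-! ### Passage to the limit in `L²` -/

section Limits

variable {α 𝕜 : Type*} [MeasurableSpace α] [RCLike 𝕜] {μ : Measure α}

/-- Continuity of the `L²` inner product, phrased for representatives. It is used for real random
variables and for complex functions on `[-π, π]`. -/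
theorem tendsto_integral_inner {f g : ℕ → α → 𝕜} {f' g' : α → 𝕜}
    (hf : ∀ N, MemLp (f N) 2 μ) (hg : ∀ N, MemLp (g N) 2 μ) (hf' : MemLp f' 2 μ)
    (hg' : MemLp g' 2 μ)
    (hff : Tendsto (fun N => eLpNorm (fun x => f N x - f' x) 2 μ) atTop (𝓝 0))
    (hgg : Tendsto (fun N => eLpNorm (fun x => g N x - g' x) 2 μ) atTop (𝓝 0)) :
    Tendsto (fun N => ∫ x, inner 𝕜 (f N x) (g N x) ∂μ) atTop
      (𝓝 (∫ x, inner 𝕜 (f' x) (g' x) ∂μ)) := by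
  have key : ∀ {p q : α → 𝕜} (hp : MemLp p 2 μ) (hq : MemLp q 2 μ),
      inner 𝕜 (hp.toLp p) (hq.toLp q) = ∫ x, inner 𝕜 (p x) (q x) ∂μ := by
    intro p q hp hq
    rw [L2.inner_def]
    refine integral_congr_ae ?_
    filter_upwards [hp.coeFn_toLp, hq.coeFn_toLp] with x h1 h2
    rw [h1, h2]
  have h1 : Tendsto (fun N => (hf N).toLp (f N)) atTop (𝓝 (hf'.toLp f')) :=
    (Lp.tendsto_Lp_iff_tendsto_eLpNorm'' f hf f' hf').2 hff
  have h2 : Tendsto (fun N => (hg N).toLp (g N)) atTop (𝓝 (hg'.toLp g')) :=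
    (Lp.tendsto_Lp_iff_tendsto_eLpNorm'' g hg g' hg').2 hgg
  have h3 := h1.inner (𝕜 := 𝕜) h2
  simp_rw [key] at h3
  exact h3

theorem tendsto_eLpNorm_mul_left {c : ℝ} {k : α → 𝕜} {f : ℕ → α → 𝕜} {f' : α → 𝕜}
    (hk : ∀ x, ‖k x‖ ≤ c)
    (hff : Tendsto (fun N => eLpNorm (fun x => f N x - f' x) 2 μ) atTop (𝓝 0)) :
    Tendsto (fun N => eLpNorm (fun x => k x * f N x - k x * f' x) 2 μ) atTop (𝓝 0) := by
  have h1 : ∀ N, eLpNorm (fun x => k x * f N x - k x * f' x) 2 μ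
      ≤ ENNReal.ofReal c * eLpNorm (fun x => f N x - f' x) 2 μ := fun N =>
    eLpNorm_le_mul_eLpNorm_of_ae_le_mul (ae_of_all _ fun x => by
      rw [← mul_sub, norm_mul]
      exact mul_le_mul_of_nonneg_right (hk x) (norm_nonneg _)) 2
  refine tendsto_of_tendsto_of_tendsto_of_le_of_le tendsto_const_nhds ?_ (fun _ => zero_le) h1
  simpa using ENNReal.Tendsto.const_mul hff (Or.inr ENNReal.ofReal_ne_top)

end Limits

/-! ### The two relative errors as integrals against the squared kernel -/

section Errors

open scoped ComplexConjugate

theorem continuous_kern (n j : ℕ) : Continuous (kern n j) := by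
  unfold kern; fun_prop

theorem continuous_partialTransfer (a : ℕ → ℝ) (N : ℕ) : Continuous (partialTransfer a N) := by
  unfold partialTransfer; fun_prop

theorem norm_kern_le (n j : ℕ) (u : ℝ) : ‖kern n j u‖ ≤ n := by
  unfold kern
  refine (norm_sum_le _ _).trans ?_
  have : ∀ t ∈ Finset.Icc 1 n, ‖Complex.exp (Complex.I * freq n j * t) *
      Complex.exp (-(Complex.I * t * u))‖ ≤ 1 := by
    intro t _
    rw [← Complex.exp_add, Complex.norm_exp]
    simp
  simpa using Finset.sum_le_card_nsmul _ _ _ this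

/-- Mean square of a relative error of the transfer function against the kernel `kern n j`. -/
noncomputable def sqErr (n j : ℕ) (G : ℝ → ℂ) : ℝ :=
  (2 * π * n)⁻¹ * ∫ u in Set.Icc (-π) π, ‖kern n j u‖ ^ 2 * ‖G u‖ ^ 2

/-- Mean of a relative error of the transfer function against the kernel `kern n j`. -/
noncomputable def meanErr (n j : ℕ) (G : ℝ → ℂ) : ℂ :=
  ((2 * π * n)⁻¹ : ℝ) * ∫ u in Set.Icc (-π) π, ((‖kern n j u‖ ^ 2 : ℝ) : ℂ) * conj (G u)

theorem ofReal_sqErr (n j : ℕ) (G : ℝ → ℂ) : ((sqErr n j G : ℝ) : ℂ) = ((2 * π * n)⁻¹ : ℝ) *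
    ∫ u in Set.Icc (-π) π, inner ℂ (kern n j u * G u) (kern n j u * G u) := by
  rw [sqErr, Complex.ofReal_mul, ← integral_complex_ofReal]
  congr 1
  refine integral_congr_ae (ae_of_all _ fun u => ?_)
  simp only [inner_self_eq_norm_sq_to_K, norm_mul]
  push_cast; ring_nf; rfl

theorem meanErr_eq (n j : ℕ) (G : ℝ → ℂ) : meanErr n j G = ((2 * π * n)⁻¹ : ℝ) *
    ∫ u in Set.Icc (-π) π, inner ℂ (kern n j u * G u) (kern n j u * 1) := by
  rw [meanErr]
  congr 1
  refine integral_congr_ae (ae_of_all _ fun u => ?_)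
  simp only [RCLike.inner_apply, map_mul, mul_one]
  have h := Complex.mul_conj' (kern n j u)
  push_cast
  rw [← h]; ring

theorem sub_vec_trig (a : ℕ → ℝ) (α : ℂ) (n N j : ℕ) (u : ℝ) :
    trig u (processVec a α n N j - innovationVec n j) =
      ((1 / √n : ℝ) : ℂ) * (kern n j u * conj (partialTransfer a N u / α - 1)) := by
  rw [map_sub, trig_processVec, trig_innovationVec, map_sub, map_one]; ring

theorem support_sub_vec (a : ℕ → ℝ) (α : ℂ) (n N j : ℕ) :
    (processVec a α n N j - innovationVec n j).support ⊆ Finset.Icc (-(N : ℤ)) n :=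
  Finsupp.support_sub.trans
    (Finset.union_subset (support_processVec a α n N j) (support_innovationVec n j N))

theorem one_div_sqrt_mul_self (n : ℕ) :
    ((1 / √n : ℝ) : ℂ) * ((1 / √n : ℝ) : ℂ) = ((n : ℝ)⁻¹ : ℝ) := by
  rw [← Complex.ofReal_mul, div_mul_div_comm, Real.mul_self_sqrt (Nat.cast_nonneg _)]
  simp

/-- Parseval applied to `δ_j`: the only information about the filter that enters `‖δ_j‖²` is the
relative error of its symbol. -/
theorem sum_norm_sq_sub_vec (a : ℕ → ℝ) (α : ℂ) (n N j : ℕ) :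
    ∑ m ∈ Finset.Icc (-(N : ℤ)) n, ‖(processVec a α n N j - innovationVec n j) m‖ ^ 2
      = sqErr n j fun u => partialTransfer a N u / α - 1 := by
  have h := sum_mul_conj_eq_integral (support_sub_vec a α n N j) (support_sub_vec a α n N j)
  have h1 : ∀ u, trig u (processVec a α n N j - innovationVec n j) *
      conj (trig u (processVec a α n N j - innovationVec n j)) =
      ((n : ℝ)⁻¹ : ℝ) * ((‖kern n j u‖ ^ 2 * ‖partialTransfer a N u / α - 1‖ ^ 2 : ℝ) : ℂ) := by
    intro u
    rw [sub_vec_trig, map_mul, Complex.conj_ofReal, mul_mul_mul_comm, one_div_sqrt_mul_self,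
      Complex.mul_conj', norm_mul, RCLike.norm_conj]
    push_cast; ring
  simp_rw [h1, Complex.mul_conj'] at h
  rw [integral_const_mul, integral_complex_ofReal] at h
  have h2 : (∑ m ∈ Finset.Icc (-(N : ℤ)) n,
      ‖(processVec a α n N j - innovationVec n j) m‖ ^ 2 : ℝ) = (2 * π)⁻¹ * ((n : ℝ)⁻¹ *
      ∫ u in Set.Icc (-π) π, ‖kern n j u‖ ^ 2 * ‖partialTransfer a N u / α - 1‖ ^ 2) := by
    exact_mod_cast h
  rw [h2, sqErr, mul_inv (2 * π)]; ring

theorem sum_sub_vec_mul_conj (a : ℕ → ℝ) (α : ℂ) (n N j : ℕ) :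
    ∑ m ∈ Finset.Icc (-(N : ℤ)) n, (processVec a α n N j - innovationVec n j) m *
        conj (innovationVec n j m)
      = meanErr n j fun u => partialTransfer a N u / α - 1 := by
  rw [sum_mul_conj_eq_integral (support_sub_vec a α n N j) (support_innovationVec n j N)]
  have h1 : ∀ u, trig u (processVec a α n N j - innovationVec n j) *
      conj (trig u (innovationVec n j)) = ((n : ℝ)⁻¹ : ℝ) * (((‖kern n j u‖ ^ 2 : ℝ) : ℂ)
        * conj (partialTransfer a N u / α - 1)) := by
    intro u
    rw [sub_vec_trig, trig_innovationVec, map_mul, Complex.conj_ofReal, mul_mul_mul_comm,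
      one_div_sqrt_mul_self, mul_right_comm, Complex.mul_conj']
    push_cast; ring
  simp_rw [h1]
  rw [integral_const_mul, meanErr, mul_inv (2 * π)]
  push_cast; ring

/-- For fixed `n` the kernel is bounded by `n`, so multiplying by it preserves `L²` convergence.
Uniformity in `n` and `j` is not needed here, as the estimates are made on the limit `A`. -/
theorem IsTransferFunction.tendsto_kern_mul {a : ℕ → ℝ} {A : ℝ → ℂ} (h : IsTransferFunction a A)
    (α : ℂ) (n j : ℕ) : Tendsto (fun N : ℕ => eLpNorm (fun u : ℝ =>
      kern n j u * (partialTransfer a N u / α - 1) - kern n j u * (A u / α - 1)) 2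
      (volume.restrict (Set.Icc (-π) π))) atTop (𝓝 0) := by
  refine tendsto_eLpNorm_mul_left (c := n) (norm_kern_le n j) ?_
  have h1 := tendsto_eLpNorm_mul_left (c := ‖α⁻¹‖) (k := fun _ : ℝ => α⁻¹)
    (f := fun N u => partialTransfer a N u) (f' := A)
    (μ := volume.restrict (Set.Icc (-π) π)) (fun _ => le_rfl) (by
      refine h.tendsto.congr fun N => ?_
      exact eLpNorm_sub_comm A (partialTransfer a N) 2 _)
  refine h1.congr fun N => ?_
  congr 1
  ext u; ring

theorem IsTransferFunction.memLp_kern_mul {a : ℕ → ℝ} {A : ℝ → ℂ} (h : IsTransferFunction a A)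
    (α : ℂ) (n j : ℕ) : MemLp (fun u => kern n j u * (A u / α - 1)) 2
      (volume.restrict (Set.Icc (-π) π)) := by
  have h1 : MemLp (fun u => A u / α - 1) 2 (volume.restrict (Set.Icc (-π) π)) := by
    simp_rw [div_eq_inv_mul]
    exact (h.memLp.const_mul _).sub (memLp_const 1)
  refine h1.of_le_mul (c := n)
    ((continuous_kern n j).aestronglyMeasurable.mul h1.aestronglyMeasurable)
    (ae_of_all _ fun u => ?_)
  rw [norm_mul]
  exact mul_le_mul_of_nonneg_right (norm_kern_le n j u) (norm_nonneg _)

theorem memLp_of_continuous {f : ℝ → ℂ} (h : Continuous f) :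
    MemLp f 2 (volume.restrict (Set.Icc (-π) π)) := by
  obtain ⟨c, hc⟩ := isCompact_Icc.exists_bound_of_continuousOn (h.continuousOn (s := Set.Icc (-π) π))
  exact MemLp.of_bound h.aestronglyMeasurable c
    ((ae_restrict_iff' measurableSet_Icc).2 (ae_of_all _ hc))

theorem IsTransferFunction.tendsto_sqErr {a : ℕ → ℝ} {A : ℝ → ℂ} (h : IsTransferFunction a A)
    (α : ℂ) (n j : ℕ) : Tendsto (fun N => sqErr n j fun u => partialTransfer a N u / α - 1) atTop
      (𝓝 (sqErr n j fun u => A u / α - 1)) := by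
  have hN : ∀ N, MemLp (fun u => kern n j u * (partialTransfer a N u / α - 1)) 2
      (volume.restrict (Set.Icc (-π) π)) := fun N => memLp_of_continuous
    ((continuous_kern n j).mul (((continuous_partialTransfer a N).div_const α).sub continuous_const))
  have h1 := (tendsto_integral_inner hN hN (h.memLp_kern_mul α n j) (h.memLp_kern_mul α n j)
    (h.tendsto_kern_mul α n j) (h.tendsto_kern_mul α n j)).const_mul (((2 * π * n)⁻¹ : ℝ) : ℂ)
  simp_rw [← ofReal_sqErr] at h1
  have h2 := (Complex.continuous_re.tendsto _).comp h1
  simpa [Function.comp_def] using h2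

theorem IsTransferFunction.tendsto_meanErr {a : ℕ → ℝ} {A : ℝ → ℂ} (h : IsTransferFunction a A)
    (α : ℂ) (n j : ℕ) : Tendsto (fun N => meanErr n j fun u => partialTransfer a N u / α - 1) atTop
      (𝓝 (meanErr n j fun u => A u / α - 1)) := by
  have hN : ∀ N, MemLp (fun u => kern n j u * (partialTransfer a N u / α - 1)) 2
      (volume.restrict (Set.Icc (-π) π)) := fun N => memLp_of_continuous
    ((continuous_kern n j).mul (((continuous_partialTransfer a N).div_const α).sub continuous_const))
  have hk : MemLp (fun u => kern n j u * 1) 2 (volume.restrict (Set.Icc (-π) π)) :=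
    memLp_of_continuous ((continuous_kern n j).mul continuous_const)
  have h1 := (tendsto_integral_inner hN (fun _ => hk) (h.memLp_kern_mul α n j) hk
    (h.tendsto_kern_mul α n j) (by simp)).const_mul (((2 * π * n)⁻¹ : ℝ) : ℂ)
  simp_rw [← meanErr_eq] at h1
  exact h1

end Errors

/-! ### Mean and variance for the truncated filter -/

section Truncated

open scoped ComplexConjugate

variable {Ω : Type*} [MeasurableSpace Ω] {P : Measure Ω} [IsProbabilityMeasure P]

/-- Mean and variance bound for the approximation error of the truncated linear process. -/
theorem R_partialProcess_bound {ζ : ℤ → Ω → ℝ} {m : ℝ} (hζ : StandardizedFourth P ζ m)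
    (a : ℕ → ℝ) (f : ℝ → ℝ) (A : ℝ → ℂ) (n N : ℕ) (b : ℕ → ℕ → ℝ)
    (hA : ∀ j ∈ Finset.Icc 1 (nu n), ‖A (freq n j)‖ ^ 2 = 2 * π * f (freq n j)) :
    MemLp (R b f (partialProcess a ζ N) ζ n) 2 P ∧
    ∫ ω, R b f (partialProcess a ζ N) ζ n ω ∂P = ∑ j ∈ Finset.Icc 1 (nu n), b n j *
      (2 * (meanErr n j fun u => partialTransfer a N u / A (freq n j) - 1).re
        + sqErr n j fun u => partialTransfer a N u / A (freq n j) - 1) ∧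
    ∫ ω, (R b f (partialProcess a ζ N) ζ n ω - ∫ ω', R b f (partialProcess a ζ N) ζ n ω' ∂P) ^ 2 ∂P
      ≤ (m + 2) * (6 * ∑ j ∈ Finset.Icc 1 (nu n), b n j ^ 2 *
          (sqErr n j fun u => partialTransfer a N u / A (freq n j) - 1)
        + 3 * (∑ j ∈ Finset.Icc 1 (nu n), |b n j| *
          sqErr n j fun u => partialTransfer a N u / A (freq n j) - 1) ^ 2) := by
  set S : Finset ℤ := Finset.Icc (-(N : ℤ)) n with hS
  set T : Finset ℕ := Finset.Icc 1 (nu n) with hT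
  have hm : 0 ≤ m := le_trans (integral_nonneg fun ω => by positivity) (hζ.fourth 0)
  set c : ℕ → ℤ →₀ ℂ := fun j => processVec a (A (freq n j)) n N j with hc
  set e : ℕ → ℤ →₀ ℂ := fun j => innovationVec n j with he
  set M : ℤ → ℤ → ℝ := fun p q => ∑ j ∈ T, b n j *
    ((c j p * conj (c j q)).re - (e j p * conj (e j q)).re) with hM
  have hR : R b f (partialProcess a ζ N) ζ n = quadForm M S ζ := by
    ext ω
    have h1 : R b f (partialProcess a ζ N) ζ n ω = ∑ j ∈ T, b n j *
        (‖linForm ζ ω (c j)‖ ^ 2 - ‖linForm ζ ω (e j)‖ ^ 2) := by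
      rw [R, SX, Sζ, ← Finset.sum_sub_distrib]
      refine Finset.sum_congr rfl fun j hj => ?_
      rw [periodogram_partialProcess_div a ζ n N j ω (hA j hj), two_pi_mul_periodogram]; ring
    rw [h1]
    simp only [quadForm, hM, Finset.sum_mul]
    rw [Finset.sum_congr rfl fun p _ => Finset.sum_comm, Finset.sum_comm]
    refine Finset.sum_congr rfl fun j _ => ?_
    rw [norm_sq_linForm ζ ω (support_processVec a _ n N j),
      norm_sq_linForm ζ ω (support_innovationVec n j N), ← Finset.sum_sub_distrib, Finset.mul_sum]
    refine Finset.sum_congr rfl fun p _ => ?_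
    rw [← Finset.sum_sub_distrib, Finset.mul_sum]
    exact Finset.sum_congr rfl fun q _ => by ring
  obtain ⟨h1, h2, h3⟩ := hζ.quadForm_bound S M
  have hce : ∀ j p, c j p = e j p + (c j - e j) p := by intro j p; simp
  -- The trace is computed entrywise from `|e + δ|² - |e|² = 2 Re(δ ē) + |δ|²`.
  have hmean : ∑ p ∈ S, M p p = ∑ j ∈ T, b n j *
      (2 * (meanErr n j fun u => partialTransfer a N u / A (freq n j) - 1).re
        + sqErr n j fun u => partialTransfer a N u / A (freq n j) - 1) := by
    simp only [hM]
    rw [Finset.sum_comm]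
    refine Finset.sum_congr rfl fun j _ => ?_
    rw [← Finset.mul_sum, ← sum_norm_sq_sub_vec, ← sum_sub_vec_mul_conj, Complex.re_sum,
      Finset.mul_sum _ _ (2 : ℝ), ← Finset.sum_add_distrib]
    congr 1
    refine Finset.sum_congr rfl fun p _ => ?_
    change _ = 2 * ((c j - e j) p * conj (e j p)).re + ‖(c j - e j) p‖ ^ 2
    rw [hce j p, ← Complex.normSq_eq_norm_sq, Complex.normSq_apply]
    simp only [Complex.mul_re, Complex.conj_re, Complex.conj_im, Complex.add_re, Complex.add_im]
    ring
  have hT' : ∀ j ∈ T, j < n := by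
    intro j hj
    simp only [hT, Finset.mem_Icc, nu] at hj
    omega
  have hfrob : ∑ p ∈ S, ∑ q ∈ S, M p q ^ 2 ≤ 6 * ∑ j ∈ T, b n j ^ 2 *
          (sqErr n j fun u => partialTransfer a N u / A (freq n j) - 1)
        + 3 * (∑ j ∈ T, |b n j| *
          sqErr n j fun u => partialTransfer a N u / A (freq n j) - 1) ^ 2 := by
    have h4 := (orthonormalOn_innovationVec (N := N) hT').frobenius_le (b n)
      (fun j => (c j - e j : ℤ →₀ ℂ))
    simp only [hc, he] at h4
    simp_rw [sum_norm_sq_sub_vec] at h4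
    refine le_trans (Finset.sum_le_sum fun p _ => Finset.sum_le_sum fun q _ => ?_) h4
    -- The real matrix is the entrywise real part of the complex one, so its Frobenius norm is no
    -- larger.
    have h5 : M p q = (∑ j ∈ T, (b n j : ℂ) * ((e j p + (c j - e j) p) *
        conj (e j q + (c j - e j) q) - e j p * conj (e j q))).re := by
      rw [Complex.re_sum]
      refine Finset.sum_congr rfl fun j _ => ?_
      rw [← hce, ← hce, Complex.re_ofReal_mul, Complex.sub_re]
    rw [h5, ← sq_abs]
    gcongr
    exact Complex.abs_re_le_norm _
  rw [hR]
  refine ⟨h1, h2.trans hmean, ?_⟩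
  rw [h2]
  exact h3.trans (mul_le_mul_of_nonneg_left hfrob (by linarith))

end Truncated

/-! ### Removing the truncation -/

section ProcessLimit

open scoped ComplexConjugate

variable {Ω : Type*} [MeasurableSpace Ω] {P : Measure Ω}

/-- Fatou's lemma for second moments. -/
theorem memLp_two_of_tendsto_ae {Y : ℕ → Ω → ℝ} {Y' : Ω → ℝ} {V : ℕ → ℝ} {V' : ℝ}
    (hY : ∀ k, MemLp (Y k) 2 P) (hYV : ∀ k, ∫ ω, Y k ω ^ 2 ∂P ≤ V k)
    (hlim : ∀ᵐ ω ∂P, Tendsto (fun k => Y k ω) atTop (𝓝 (Y' ω)))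
    (hV : Tendsto V atTop (𝓝 V')) :
    MemLp Y' 2 P ∧ ∫ ω, Y' ω ^ 2 ∂P ≤ V' := by
  have hmeas : AEStronglyMeasurable Y' P :=
    aestronglyMeasurable_of_tendsto_ae atTop (fun k => (hY k).aestronglyMeasurable) hlim
  have hV' : 0 ≤ V' := ge_of_tendsto' hV fun k =>
    (integral_nonneg fun ω => sq_nonneg (Y k ω)).trans (hYV k)
  have hle : ∫⁻ ω, ENNReal.ofReal (Y' ω ^ 2) ∂P ≤ ENNReal.ofReal V' := by
    calc ∫⁻ ω, ENNReal.ofReal (Y' ω ^ 2) ∂P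
        = ∫⁻ ω, liminf (fun k => ENNReal.ofReal (Y k ω ^ 2)) atTop ∂P := by
          refine lintegral_congr_ae ?_
          filter_upwards [hlim] with ω hω
          exact ((ENNReal.continuous_ofReal.tendsto _).comp (hω.pow 2)).liminf_eq.symm
      _ ≤ liminf (fun k => ∫⁻ ω, ENNReal.ofReal (Y k ω ^ 2) ∂P) atTop :=
          lintegral_liminf_le' fun k =>
            ((hY k).aestronglyMeasurable.aemeasurable.pow_const 2).ennreal_ofReal
      _ ≤ liminf (fun k => ENNReal.ofReal (V k)) atTop := by
          refine liminf_le_liminf (Eventually.of_forall fun k => ?_)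
          rw [← ofReal_integral_eq_lintegral_ofReal (hY k).integrable_sq
            (ae_of_all _ fun ω => sq_nonneg _)]
          exact ENNReal.ofReal_le_ofReal (hYV k)
      _ = ENNReal.ofReal V' := ((ENNReal.continuous_ofReal.tendsto _).comp hV).liminf_eq
  have hint : Integrable (fun ω => Y' ω ^ 2) P := by
    refine ⟨hmeas.pow 2, ?_⟩
    rw [hasFiniteIntegral_iff_ofReal (ae_of_all _ fun ω => sq_nonneg _)]
    exact hle.trans_lt ENNReal.ofReal_lt_top
  refine ⟨(memLp_two_iff_integrable_sq hmeas).2 hint, ?_⟩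
  rw [← ENNReal.ofReal_le_ofReal_iff hV', ofReal_integral_eq_lintegral_ofReal hint
    (ae_of_all _ fun ω => sq_nonneg _)]
  exact hle

/-- Periodogram as a quadratic form. -/
theorem periodogram_eq_sum {Ω : Type*} (Y : ℤ → Ω → ℝ) (n j : ℕ) (ω : Ω) :
    periodogram Y n j ω = ∑ s ∈ Finset.Icc 1 n, ∑ t ∈ Finset.Icc 1 n, (2 * π * n)⁻¹ *
      (Complex.exp (Complex.I * freq n j * s) * conj (Complex.exp (Complex.I * freq n j * t))).re
        * (Y s ω * Y t ω) := by
  have h2 : ∀ z : ℂ, ‖z‖ ^ 2 = (z * conj z).re := by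
    intro z
    rw [Complex.mul_conj', ← Complex.ofReal_pow, Complex.ofReal_re]
  rw [periodogram, dft, norm_mul, mul_pow, h2 (∑ k ∈ _, _), map_sum, Finset.sum_mul_sum,
    Complex.re_sum, Finset.mul_sum, Complex.norm_real, Real.norm_eq_abs, sq_abs, div_pow,
    Real.sq_sqrt (by positivity)]
  refine Finset.sum_congr rfl fun s _ => ?_
  rw [Complex.re_sum, Finset.mul_sum]
  refine Finset.sum_congr rfl fun t _ => ?_
  rw [map_mul, Complex.conj_ofReal, mul_mul_mul_comm, ← Complex.ofReal_mul, Complex.re_mul_ofReal]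
  ring

/-- The kernel `κ` does not depend on the process, so convergence of the finitely many variables `Y
1, …, Y n` carries over to `SX`. -/
theorem SX_eq_sum {Ω : Type*} (b : ℕ → ℕ → ℝ) (f : ℝ → ℝ) (n : ℕ) :
    ∃ κ : ℕ → ℕ → ℝ, ∀ (Y : ℤ → Ω → ℝ) (ω : Ω), SX b f Y n ω =
      ∑ s ∈ Finset.Icc 1 n, ∑ t ∈ Finset.Icc 1 n, κ s t * (Y s ω * Y t ω) := by
  refine ⟨fun s t => ∑ j ∈ Finset.Icc 1 (nu n), b n j * ((2 * π * n)⁻¹ *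
      (Complex.exp (Complex.I * freq n j * s) *
        conj (Complex.exp (Complex.I * freq n j * t))).re) / f (freq n j), fun Y ω => ?_⟩
  simp only [SX, periodogram_eq_sum, Finset.sum_div, Finset.mul_sum, Finset.sum_mul]
  rw [Finset.sum_comm]
  refine Finset.sum_congr rfl fun s _ => ?_
  rw [Finset.sum_comm]
  exact Finset.sum_congr rfl fun t _ => Finset.sum_congr rfl fun j _ => by ring

theorem integrable_periodogram {Y : ℤ → Ω → ℝ} (hY : ∀ t, MemLp (Y t) 2 P) (n j : ℕ) :
    Integrable (periodogram Y n j) P := by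
  have : periodogram Y n j = fun ω => periodogram Y n j ω := rfl
  rw [this]
  simp only [periodogram_eq_sum]
  exact integrable_finsetSum _ fun s _ => integrable_finsetSum _ fun t _ =>
    ((hY s).integrable_mul (hY t)).const_mul _

theorem integrable_Sζ {ζ : ℤ → Ω → ℝ} (hζ : ∀ t, MemLp (ζ t) 2 P) (b : ℕ → ℕ → ℝ) (n : ℕ) :
    Integrable (Sζ b ζ n) P :=
  integrable_finsetSum _ fun j _ => ((integrable_periodogram hζ n j).const_mul _).const_mul _

theorem integrable_SX {Y : ℤ → Ω → ℝ} (hY : ∀ t, MemLp (Y t) 2 P) (b : ℕ → ℕ → ℝ) (f : ℝ → ℝ)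
    (n : ℕ) : Integrable (SX b f Y n) P :=
  integrable_finsetSum _ fun j _ => ((integrable_periodogram hY n j).div_const _).const_mul _

theorem memLp_partialProcess {ζ : ℤ → Ω → ℝ} (hζ : ∀ t, MemLp (ζ t) 2 P) (a : ℕ → ℝ) (N : ℕ)
    (t : ℤ) : MemLp (partialProcess a ζ N t) 2 P :=
  memLp_finsetSum _ fun _ _ => (hζ _).const_mul _

theorem IsLinearProcess.tendsto_partialProcess {a : ℕ → ℝ} {ζ X : ℤ → Ω → ℝ}
    (hX : IsLinearProcess P a ζ X) (t : ℤ) :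
    Tendsto (fun N => eLpNorm (fun ω => partialProcess a ζ N t ω - X t ω) 2 P) atTop (𝓝 0) :=
  (hX.tendsto t).congr fun N => eLpNorm_sub_comm (X t) (partialProcess a ζ N t) 2 P

theorem IsLinearProcess.tendsto_integral_mul {a : ℕ → ℝ} {ζ X : ℤ → Ω → ℝ}
    (hζ : ∀ t, MemLp (ζ t) 2 P) (hX : IsLinearProcess P a ζ X) (s t : ℤ) :
    Tendsto (fun N => ∫ ω, partialProcess a ζ N s ω * partialProcess a ζ N t ω ∂P) atTop
      (𝓝 (∫ ω, X s ω * X t ω ∂P)) := by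
  have h := tendsto_integral_inner (𝕜 := ℝ) (fun N => memLp_partialProcess hζ a N t)
    (fun N => memLp_partialProcess hζ a N s) (hX.memLp t) (hX.memLp s)
    (hX.tendsto_partialProcess t) (hX.tendsto_partialProcess s)
  simpa using h

theorem IsLinearProcess.tendsto_integral_R {a : ℕ → ℝ} {ζ X : ℤ → Ω → ℝ}
    (hζ : ∀ t, MemLp (ζ t) 2 P) (hX : IsLinearProcess P a ζ X) (b : ℕ → ℕ → ℝ) (f : ℝ → ℝ)
    (n : ℕ) : Tendsto (fun N => ∫ ω, R b f (partialProcess a ζ N) ζ n ω ∂P) atTop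
      (𝓝 (∫ ω, R b f X ζ n ω ∂P)) := by
  obtain ⟨κ, hκ⟩ := SX_eq_sum (Ω := Ω) b f n
  have h1 : ∀ Y : ℤ → Ω → ℝ, (∀ t, MemLp (Y t) 2 P) → ∫ ω, R b f Y ζ n ω ∂P =
      ∑ s ∈ Finset.Icc 1 n, ∑ t ∈ Finset.Icc 1 n, κ s t * ∫ ω, Y s ω * Y t ω ∂P
        - ∫ ω, Sζ b ζ n ω ∂P := by
    intro Y hY
    have hint : ∀ s t : ℕ, Integrable (fun ω => κ s t * (Y s ω * Y t ω)) P :=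
      fun s t => ((hY s).integrable_mul (hY t)).const_mul _
    simp only [R]
    rw [integral_sub (integrable_SX hY b f n) (integrable_Sζ hζ b n)]
    simp_rw [hκ Y]
    rw [integral_finsetSum _ fun s _ => integrable_finsetSum _ fun t _ => hint s t]
    congr 1
    refine Finset.sum_congr rfl fun s _ => ?_
    rw [integral_finsetSum _ fun t _ => hint s t]
    exact Finset.sum_congr rfl fun t _ => integral_const_mul _ _
  rw [h1 X hX.memLp]
  simp_rw [h1 _ (memLp_partialProcess hζ a _)]
  refine Tendsto.sub_const (tendsto_finsetSum _ fun s _ => tendsto_finsetSum _ fun t _ => ?_) _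
  exact (hX.tendsto_integral_mul hζ s t).const_mul _

/-- Mean square convergence gives almost sure convergence along a subsequence. Applying this to the
sum of the `n` absolute errors yields a single subsequence valid for all times. -/
theorem IsLinearProcess.exists_subseq_tendsto_R {a : ℕ → ℝ} {ζ X : ℤ → Ω → ℝ}
    (hζ : ∀ t, MemLp (ζ t) 2 P) (hX : IsLinearProcess P a ζ X) (b : ℕ → ℕ → ℝ) (f : ℝ → ℝ)
    (n : ℕ) : ∃ N : ℕ → ℕ, StrictMono N ∧ ∀ᵐ ω ∂P,
      Tendsto (fun k => R b f (partialProcess a ζ (N k)) ζ n ω) atTop (𝓝 (R b f X ζ n ω)) := by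
  obtain ⟨κ, hκ⟩ := SX_eq_sum (Ω := Ω) b f n
  set D : ℕ → ℕ → Ω → ℝ := fun N t ω => partialProcess a ζ N t ω - X t ω with hD
  have hDmem : ∀ N t, MemLp (D N t) 2 P := fun N t =>
    (memLp_partialProcess hζ a N t).sub (hX.memLp t)
  set g : ℕ → Ω → ℝ := fun N ω => ∑ t ∈ Finset.Icc 1 n, ‖D N t ω‖ with hg
  have hg0 : Tendsto (fun N => eLpNorm (g N - 0) 2 P) atTop (𝓝 0) := by
    have h1 : Tendsto (fun N => ∑ t ∈ Finset.Icc 1 n, eLpNorm (D N t) 2 P) atTop (𝓝 0) := by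
      simpa using tendsto_finsetSum (Finset.Icc 1 n) fun t _ => hX.tendsto_partialProcess (t : ℤ)
    refine tendsto_of_tendsto_of_tendsto_of_le_of_le tendsto_const_nhds h1 (fun _ => zero_le)
      fun N => ?_
    have h2 : g N - 0 = ∑ t ∈ Finset.Icc 1 n, fun ω => ‖D N t ω‖ := by
      ext ω; simp [hg]
    rw [h2]
    refine (eLpNorm_sum_le (fun t _ => (hDmem N t).norm.aestronglyMeasurable)
      (by norm_num)).trans (le_of_eq ?_)
    exact Finset.sum_congr rfl fun t _ => eLpNorm_norm _
  have hgm : TendstoInMeasure P g atTop 0 :=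
    tendstoInMeasure_of_tendsto_eLpNorm (by norm_num)
      (fun N => (memLp_finsetSum (Finset.Icc 1 n) fun t _ => (hDmem N t).norm).aestronglyMeasurable)
      aestronglyMeasurable_zero hg0
  obtain ⟨ns, hns, hae⟩ := hgm.exists_seq_tendsto_ae
  refine ⟨ns, hns, ?_⟩
  filter_upwards [hae] with ω hω
  have hpt : ∀ t ∈ Finset.Icc 1 n,
      Tendsto (fun k => partialProcess a ζ (ns k) t ω) atTop (𝓝 (X t ω)) := by
    intro t ht
    rw [tendsto_iff_norm_sub_tendsto_zero]
    refine squeeze_zero (fun _ => norm_nonneg _) (fun k => ?_) hω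
    exact Finset.single_le_sum (f := fun t : ℕ => ‖D (ns k) t ω‖) (fun _ _ => norm_nonneg _) ht
  simp only [R, hκ]
  refine Tendsto.sub_const (tendsto_finsetSum _ fun s hs => tendsto_finsetSum _ fun t ht => ?_) _
  exact ((hpt s hs).mul (hpt t ht)).const_mul _

/-- Mean and variance bound for the approximation error of the linear process. -/
theorem IsLinearProcess.R_bound [IsProbabilityMeasure P] {a : ℕ → ℝ} {ζ X : ℤ → Ω → ℝ} {m : ℝ}
    (hζ : StandardizedFourth P ζ m) (hX : IsLinearProcess P a ζ X) {f : ℝ → ℝ} {A : ℝ → ℂ}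
    (hA : IsTransferFunction a A) {n : ℕ}
    (hAf : ∀ j ∈ Finset.Icc 1 (nu n), ‖A (freq n j)‖ ^ 2 = 2 * π * f (freq n j))
    (b : ℕ → ℕ → ℝ) :
    MemLp (R b f X ζ n) 2 P ∧
    ∫ ω, R b f X ζ n ω ∂P = ∑ j ∈ Finset.Icc 1 (nu n), b n j *
      (2 * (meanErr n j fun u => A u / A (freq n j) - 1).re
        + sqErr n j fun u => A u / A (freq n j) - 1) ∧
    ∫ ω, (R b f X ζ n ω - ∫ ω', R b f X ζ n ω' ∂P) ^ 2 ∂P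
      ≤ (m + 2) * (6 * ∑ j ∈ Finset.Icc 1 (nu n), b n j ^ 2 *
          (sqErr n j fun u => A u / A (freq n j) - 1)
        + 3 * (∑ j ∈ Finset.Icc 1 (nu n), |b n j| *
          sqErr n j fun u => A u / A (freq n j) - 1) ^ 2) := by
  have hζ2 := hζ.memLp_two
  have hb := fun N => R_partialProcess_bound hζ a f A n N b hAf
  have hmean := hX.tendsto_integral_R hζ2 b f n
  obtain ⟨ns, hns, hae⟩ := hX.exists_subseq_tendsto_R hζ2 b f n
  have hsq := fun j => hA.tendsto_sqErr (A (freq n j)) n j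
  have hme := fun j => hA.tendsto_meanErr (A (freq n j)) n j
  have hlim : Tendsto (fun N => (m + 2) * (6 * ∑ j ∈ Finset.Icc 1 (nu n), b n j ^ 2 *
          (sqErr n j fun u => partialTransfer a N u / A (freq n j) - 1)
        + 3 * (∑ j ∈ Finset.Icc 1 (nu n), |b n j| *
          sqErr n j fun u => partialTransfer a N u / A (freq n j) - 1) ^ 2)) atTop
      (𝓝 ((m + 2) * (6 * ∑ j ∈ Finset.Icc 1 (nu n), b n j ^ 2 *
          (sqErr n j fun u => A u / A (freq n j) - 1)
        + 3 * (∑ j ∈ Finset.Icc 1 (nu n), |b n j| *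
          sqErr n j fun u => A u / A (freq n j) - 1) ^ 2))) := by
    refine Tendsto.const_mul _ (Tendsto.add (Tendsto.const_mul _ ?_)
      (Tendsto.const_mul _ (Tendsto.pow ?_ 2)))
    · exact tendsto_finsetSum _ fun j _ => (hsq j).const_mul _
    · exact tendsto_finsetSum _ fun j _ => (hsq j).const_mul _
  -- Convergence of the second moments of `R` is not available, but Fatou along the subsequence
  -- gives the upper bound that is needed. The mean, where equality is required, passes to the limit
  -- directly.
  obtain ⟨h1, h2⟩ := memLp_two_of_tendsto_ae
    (Y := fun k ω => R b f (partialProcess a ζ (ns k)) ζ n ω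
      - ∫ ω', R b f (partialProcess a ζ (ns k)) ζ n ω' ∂P)
    (Y' := fun ω => R b f X ζ n ω - ∫ ω', R b f X ζ n ω' ∂P)
    (fun k => (hb (ns k)).1.sub (memLp_const _)) (fun k => (hb (ns k)).2.2)
    (by
      filter_upwards [hae] with ω hω
      exact hω.sub (hmean.comp hns.tendsto_atTop))
    (hlim.comp hns.tendsto_atTop)
  refine ⟨?_, ?_, h2⟩
  · have := h1.add (memLp_const (∫ ω', R b f X ζ n ω' ∂P))
    refine this.ae_eq (ae_of_all _ fun ω => ?_)
    simp
  · refine tendsto_nhds_unique hmean ?_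
    simp_rw [(hb _).2.1]
    refine tendsto_finsetSum _ fun j _ => Tendsto.const_mul _ (Tendsto.add ?_ (hsq j))
    exact ((Complex.continuous_re.tendsto _).comp (hme j)).const_mul 2

end ProcessLimit

/-! ### Uniqueness of Fourier coefficients of integrable functions -/

section FourierUniqueness

/-- An integrable function on `[-π, π]` whose Fourier coefficients vanish is zero almost
everywhere. -/
theorem ae_eq_zero_of_fourier_eq_zero {h : ℝ → ℂ} (hint : IntegrableOn h (Set.Icc (-π) π))
    (hcoef : ∀ k : ℤ, ∫ u in Set.Icc (-π) π, Complex.exp (Complex.I * k * u) * h u = 0) :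
    ∀ᵐ u, u ∈ Set.Ioo (-π) π → h u = 0 := by
  have hpi := Real.pi_pos
  have : Fact (0 < 2 * π) := ⟨by positivity⟩
  have hmul : ∀ G : C(AddCircle (2 * π), ℂ),
      IntegrableOn (fun u : ℝ => G (u : AddCircle (2 * π)) * h u) (Set.Icc (-π) π) := fun G =>
    hint.bdd_mul (c := ‖G‖)
      (G.continuous.comp (AddCircle.continuous_mk' _)).aestronglyMeasurable
      (ae_of_all _ fun u => G.norm_coe_le_norm _)
  -- Integration against `h` is a bounded functional on continuous functions of the circle. It kills
  -- the characters, whose span is dense, hence it is zero. Test functions supported in `(-π, π)`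
  -- vanish at both ends, so they descend to the circle.
  let Φl : C(AddCircle (2 * π), ℂ) →ₗ[ℂ] ℂ :=
    { toFun := fun G => ∫ u in Set.Icc (-π) π, G (u : AddCircle (2 * π)) * h u
      map_add' := fun G H => by
        rw [← integral_add (hmul G) (hmul H)]
        exact integral_congr_ae (ae_of_all _ fun u => by simp [add_mul])
      map_smul' := fun c G => by
        rw [RingHom.id_apply, smul_eq_mul, ← integral_const_mul]
        exact integral_congr_ae (ae_of_all _ fun u => by simp [mul_assoc]) }
  let Φ : C(AddCircle (2 * π), ℂ) →L[ℂ] ℂ :=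
    Φl.mkContinuous (∫ u in Set.Icc (-π) π, ‖h u‖) fun G => by
      change ‖∫ u in Set.Icc (-π) π, G (u : AddCircle (2 * π)) * h u‖ ≤ _
      rw [← integral_mul_const]
      refine norm_integral_le_of_norm_le (hint.norm.mul_const _) (ae_of_all _ fun u => ?_)
      rw [norm_mul, mul_comm]
      exact mul_le_mul_of_nonneg_left (G.norm_coe_le_norm _) (norm_nonneg _)
  have hker : (⊤ : Submodule ℂ C(AddCircle (2 * π), ℂ)) ≤ LinearMap.ker Φ.toLinearMap := by
    rw [← span_fourier_closure_eq_top]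
    refine Submodule.topologicalClosure_minimal _ ?_ Φ.isClosed_ker
    rw [Submodule.span_le]
    rintro _ ⟨k, rfl⟩
    change ∫ u in Set.Icc (-π) π, fourier k (u : AddCircle (2 * π)) * h u = 0
    rw [← hcoef k]
    refine integral_congr_ae (ae_of_all _ fun u => ?_)
    simp only [fourier_coe_apply]
    congr 2
    have : (π : ℂ) ≠ 0 := by exact_mod_cast hpi.ne'
    push_cast; field_simp
  have hΦ : ∀ G : C(AddCircle (2 * π), ℂ),
      ∫ u in Set.Icc (-π) π, G (u : AddCircle (2 * π)) * h u = 0 := fun G => hker trivial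
  refine isOpen_Ioo.ae_eq_zero_of_integral_contDiff_smul_eq_zero
    (hint.mono_set Set.Ioo_subset_Icc_self).locallyIntegrableOn fun g hg _ hsupp => ?_
  have hg0 : ∀ u, u ∉ Set.Ioo (-π) π → g u = 0 := fun u hu =>
    image_eq_zero_of_notMem_tsupport fun h' => hu (hsupp h')
  have hper : (fun u => (g u : ℂ)) (-π) = (fun u => (g u : ℂ)) (-π + 2 * π) := by
    simp only [hg0 (-π) (by simp), hg0 (-π + 2 * π) (fun h' => by have := h'.2; linarith)]
  let G : C(AddCircle (2 * π), ℂ) := ⟨AddCircle.liftIco (2 * π) (-π) fun u => (g u : ℂ),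
    AddCircle.liftIco_continuous hper
      (Complex.continuous_ofReal.comp hg.continuous).continuousOn⟩
  have hG : ∀ u : ℝ, u ∈ Set.Ico (-π) π → G (u : AddCircle (2 * π)) = (g u : ℂ) := fun u hu => by
    have hmem : u ∈ Set.Ico (-π) (-π + 2 * π) := ⟨hu.1, by linarith [hu.2]⟩
    exact AddCircle.liftIco_coe_apply (f := fun u => (g u : ℂ)) hmem
  have h1 : ∫ u, g u • h u = ∫ u in Set.Ico (-π) π, g u • h u := by
    rw [setIntegral_eq_integral_of_forall_compl_eq_zero]
    intro u hu
    rw [hg0 u fun h' => hu (Set.Ioo_subset_Ico_self h'), zero_smul]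
  rw [h1, ← hΦ G, integral_Icc_eq_integral_Ico]
  refine setIntegral_congr_fun measurableSet_Ico fun u hu => ?_
  simp only [hG u hu, Complex.real_smul]

end FourierUniqueness

/-! ### The spectral density as squared modulus of the transfer function -/

section Spectral

open scoped ComplexConjugate

variable {Ω : Type*} [MeasurableSpace Ω] {P : Measure Ω}

theorem StandardizedFourth.integral_mul {ι : Type*} {ζ : ι → Ω → ℝ} {m : ℝ}
    [DecidableEq ι] (hζ : StandardizedFourth P ζ m) (s t : ι) :
    ∫ ω, ζ s ω * ζ t ω ∂P = if s = t then 1 else 0 := by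
  split_ifs with h
  · subst h; simpa [sq] using hζ.variance s
  · rw [(hζ.indep.indepFun h).integral_fun_mul_eq_mul_integral
      (hζ.memLp s).aestronglyMeasurable (hζ.memLp t).aestronglyMeasurable, hζ.mean]
    simp

variable [IsProbabilityMeasure P]

/-- Both sides equal `2π` times the sum of `a p * a q` over `p - q = k`: on the left by
orthonormality of the innovations, on the right by that of the exponentials. -/
theorem integral_partialProcess_mul {ζ : ℤ → Ω → ℝ} {m : ℝ} (hζ : StandardizedFourth P ζ m)
    (a : ℕ → ℝ) (N : ℕ) (j k : ℤ) :
    (2 * π : ℂ) * ((∫ ω, partialProcess a ζ N (j + k) ω * partialProcess a ζ N j ω ∂P : ℝ) : ℂ)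
      = ∫ u in Set.Icc (-π) π, inner ℂ (partialTransfer a N u)
          (Complex.exp (Complex.I * k * u) * partialTransfer a N u) := by
  have hint : ∀ p q : ℕ, Integrable (fun ω => a p * a q * (ζ (j + k - p) ω * ζ (j - q) ω)) P :=
    fun p q => ((hζ.memLp_two _).integrable_mul (hζ.memLp_two _)).const_mul _
  have h1 : ∫ ω, partialProcess a ζ N (j + k) ω * partialProcess a ζ N j ω ∂P =
      ∑ p ∈ Finset.range N, ∑ q ∈ Finset.range N, a p * a q * if k - p + q = 0 then 1 else 0 := by
    have h2 : ∀ ω, partialProcess a ζ N (j + k) ω * partialProcess a ζ N j ω =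
        ∑ p ∈ Finset.range N, ∑ q ∈ Finset.range N,
          a p * a q * (ζ (j + k - p) ω * ζ (j - q) ω) := by
      intro ω
      rw [partialProcess, partialProcess, Finset.sum_mul_sum]
      exact Finset.sum_congr rfl fun p _ => Finset.sum_congr rfl fun q _ => by ring
    simp_rw [h2]
    rw [integral_finsetSum _ fun p _ => integrable_finsetSum _ fun q _ => hint p q]
    refine Finset.sum_congr rfl fun p _ => ?_
    rw [integral_finsetSum _ fun q _ => hint p q]
    refine Finset.sum_congr rfl fun q _ => ?_
    rw [integral_const_mul, hζ.integral_mul]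
    congr 1
    exact if_congr (by constructor <;> intro h <;> omega) rfl rfl
  have hint' : ∀ p q : ℕ, IntegrableOn (fun u : ℝ => (a p * a q : ℂ) *
      Complex.exp (Complex.I * ((k - p + q : ℤ) : ℂ) * u)) (Set.Icc (-π) π) := fun p q => by
    refine ContinuousOn.integrableOn_Icc ?_
    fun_prop
  have h3 : ∀ u : ℝ, inner ℂ (partialTransfer a N u)
      (Complex.exp (Complex.I * k * u) * partialTransfer a N u) =
      ∑ p ∈ Finset.range N, ∑ q ∈ Finset.range N, (a p * a q : ℂ) *
        Complex.exp (Complex.I * ((k - p + q : ℤ) : ℂ) * u) := by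
    intro u
    rw [RCLike.inner_apply, mul_assoc, partialTransfer, map_sum, Finset.sum_mul_sum,
      Finset.mul_sum]
    refine Finset.sum_congr rfl fun p _ => ?_
    rw [Finset.mul_sum]
    refine Finset.sum_congr rfl fun q _ => ?_
    rw [map_mul, ← Complex.exp_conj, Complex.conj_ofReal]
    simp only [map_neg, map_mul, Complex.conj_I, Complex.conj_ofReal, map_natCast]
    have : Complex.exp (Complex.I * ((k - p + q : ℤ) : ℂ) * u) = Complex.exp (Complex.I * k * u) *
        (Complex.exp (-(Complex.I * p * u)) * Complex.exp (-(-Complex.I * q * u))) := by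
      rw [← Complex.exp_add, ← Complex.exp_add]
      congr 1; push_cast; ring
    rw [this]; ring
  simp_rw [h3]
  rw [h1, integral_finsetSum _ fun p _ => integrable_finsetSum _ fun q _ => hint' p q]
  push_cast
  rw [Finset.mul_sum]
  refine Finset.sum_congr rfl fun p _ => ?_
  rw [integral_finsetSum _ fun q _ => by simpa [IntegrableOn] using hint' p q, Finset.mul_sum]
  refine Finset.sum_congr rfl fun q _ => ?_
  have h4 := integral_exp_int (k - p + q)
  push_cast at h4
  rw [integral_const_mul, h4]
  split_ifs <;> push_cast <;> ring

theorem IsLinearProcess.integral_eq_zero {a : ℕ → ℝ} {ζ X : ℤ → Ω → ℝ} {m : ℝ}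
    (hζ : StandardizedFourth P ζ m) (hX : IsLinearProcess P a ζ X) (t : ℤ) :
    ∫ ω, X t ω ∂P = 0 := by
  have h1 := tendsto_integral_inner (𝕜 := ℝ) (fun N => memLp_partialProcess hζ.memLp_two a N t)
    (fun _ => memLp_const (1 : ℝ)) (hX.memLp t) (memLp_const (1 : ℝ))
    (hX.tendsto_partialProcess t) (by simp)
  have h2 : ∀ N, ∫ ω, partialProcess a ζ N t ω ∂P = 0 := by
    intro N
    simp only [partialProcess]
    rw [integral_finsetSum _ fun k _ =>
      ((hζ.memLp_two _).integrable one_le_two).const_mul _]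
    simp [integral_const_mul, hζ.mean]
  simp only [RCLike.inner_apply, conj_trivial, one_mul, h2] at h1
  exact tendsto_nhds_unique h1 tendsto_const_nhds

/-- The spectral density is the squared modulus of the transfer function, up to `2π`. -/
theorem ae_norm_sq_transfer_eq {a : ℕ → ℝ} {ζ X : ℤ → Ω → ℝ} {m : ℝ} {f : ℝ → ℝ} {A : ℝ → ℂ}
    (hζ : StandardizedFourth P ζ m) (hX : IsLinearProcess P a ζ X) (hf : IsSpectralDensity P X f)
    (hA : IsTransferFunction a A) :
    ∀ᵐ u, u ∈ Set.Ioo (-π) π → ‖A u‖ ^ 2 = 2 * π * f u := by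
  have hAt : Tendsto (fun N => eLpNorm (fun u => partialTransfer a N u - A u) 2
      (volume.restrict (Set.Icc (-π) π))) atTop (𝓝 0) :=
    hA.tendsto.congr fun N => eLpNorm_sub_comm A (partialTransfer a N) 2 _
  have hpt := fun N => memLp_of_continuous (continuous_partialTransfer a N)
  -- The identity for truncated filters passes to the limit on both sides, and the covariance equals
  -- the product moment because `X` is centred. So `‖A‖²` and `2πf` have the same Fourier
  -- coefficients.
  have hcoef : ∀ k : ℤ, ∫ u in Set.Icc (-π) π, Complex.exp (Complex.I * k * u) *
      ((‖A u‖ ^ 2 - 2 * π * f u : ℝ) : ℂ) = 0 := by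
    intro k
    have hexp : ∀ u : ℝ, ‖Complex.exp (Complex.I * k * u)‖ ≤ 1 := by
      intro u; rw [Complex.norm_exp]; simp
    have hec : Continuous fun u : ℝ => Complex.exp (Complex.I * k * u) := by fun_prop
    have hmem : MemLp (fun u : ℝ => Complex.exp (Complex.I * k * u) * A u) 2
        (volume.restrict (Set.Icc (-π) π)) := by
      refine hA.memLp.of_le_mul (c := 1) (hec.aestronglyMeasurable.mul
        hA.memLp.aestronglyMeasurable) (ae_of_all _ fun u => ?_)
      rw [norm_mul]
      exact mul_le_mul_of_nonneg_right (hexp u) (norm_nonneg _)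
    have h1 := tendsto_integral_inner (𝕜 := ℂ) hpt
      (fun N => memLp_of_continuous (hec.mul (continuous_partialTransfer a N)))
      hA.memLp hmem hAt (tendsto_eLpNorm_mul_left hexp hAt)
    have h2 := ((Complex.continuous_ofReal.tendsto _).comp
      (hX.tendsto_integral_mul hζ.memLp_two (0 + k) 0)).const_mul (2 * π : ℂ)
    simp only [Function.comp_def, integral_partialProcess_mul hζ a _ 0 k] at h2
    have h3 := tendsto_nhds_unique h1 h2
    have h4 := hf.cov_eq 0 k
    rw [covariance_eq_sub (hX.memLp _) (hX.memLp _), hX.integral_eq_zero hζ, zero_mul,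
      sub_zero] at h4
    simp only [Pi.mul_apply] at h4
    rw [h4] at h3
    have h5 : ∀ u : ℝ, inner ℂ (A u) (Complex.exp (Complex.I * k * u) * A u)
        = Complex.exp (Complex.I * k * u) * ((‖A u‖ ^ 2 : ℝ) : ℂ) := by
      intro u
      rw [RCLike.inner_apply, mul_assoc, Complex.mul_conj']; push_cast; ring
    simp_rw [h5] at h3
    have i1 : IntegrableOn (fun u : ℝ => Complex.exp (Complex.I * k * u) * ((‖A u‖ ^ 2 : ℝ) : ℂ))
        (Set.Icc (-π) π) := by
      have : Integrable (fun u => ‖A u‖ ^ 2) (volume.restrict (Set.Icc (-π) π)) :=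
        (memLp_two_iff_integrable_sq_norm hA.memLp.aestronglyMeasurable).1 hA.memLp
      exact this.ofReal.bdd_mul (c := 1) hec.aestronglyMeasurable (ae_of_all _ hexp)
    have i2 : IntegrableOn (fun u : ℝ => (2 * π : ℂ) * (Complex.exp (Complex.I * k * u) *
        (f u : ℂ))) (Set.Icc (-π) π) :=
      Integrable.const_mul (hf.integrable.ofReal.bdd_mul (c := 1) hec.aestronglyMeasurable
        (ae_of_all _ hexp)) _
    have h6 : ∀ u : ℝ, Complex.exp (Complex.I * k * u) * ((‖A u‖ ^ 2 - 2 * π * f u : ℝ) : ℂ)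
        = Complex.exp (Complex.I * k * u) * ((‖A u‖ ^ 2 : ℝ) : ℂ)
          - (2 * π : ℂ) * (Complex.exp (Complex.I * k * u) * (f u : ℂ)) := by
      intro u; push_cast; ring
    simp_rw [h6]
    rw [integral_sub i1 i2, integral_const_mul, h3, sub_self]
  have hint : IntegrableOn (fun u : ℝ => ((‖A u‖ ^ 2 - 2 * π * f u : ℝ) : ℂ)) (Set.Icc (-π) π) := by
    have : Integrable (fun u => ‖A u‖ ^ 2) (volume.restrict (Set.Icc (-π) π)) :=
      (memLp_two_iff_integrable_sq_norm hA.memLp.aestronglyMeasurable).1 hA.memLp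
    exact (this.sub (hf.integrable.const_mul _)).ofReal
  filter_upwards [ae_eq_zero_of_fourier_eq_zero hint hcoef] with u hu hmem
  have := hu hmem
  exact sub_eq_zero.1 (by exact_mod_cast this)

end Spectral

/-! ### Decay of the Dirichlet kernel -/

section Kernel

/-- Geometric sum with ratio `z` on the unit circle, where `‖z - 1‖ = 2 |sin((u_j - u)/2)|`. -/
theorem norm_kern_mul_abs_sin_le (n j : ℕ) (u : ℝ) :
    ‖kern n j u‖ * |Real.sin ((freq n j - u) / 2)| ≤ 1 := by
  set z : ℂ := Complex.exp (Complex.I * (freq n j - u : ℝ)) with hz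
  have hzn : ∀ k : ℕ, ‖z ^ k‖ = 1 := by
    intro k
    rw [norm_pow, hz, Complex.norm_exp]; simp
  have h1 : kern n j u = z * ∑ t ∈ Finset.range n, z ^ t := by
    rw [kern, ← Finset.Ico_add_one_right_eq_Icc, Finset.sum_Ico_eq_sum_range, Nat.add_sub_cancel,
      Finset.mul_sum]
    refine Finset.sum_congr rfl fun t _ => ?_
    rw [← Complex.exp_add, ← pow_succ', hz, ← Complex.exp_nat_mul]
    congr 1; push_cast; ring
  have h2 : ‖kern n j u‖ * ‖z - 1‖ ≤ 2 := by
    rw [← norm_mul, h1]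
    have : z * (∑ t ∈ Finset.range n, z ^ t) * (z - 1) = z ^ (n + 1) - z := by
      rw [mul_assoc, geom_sum_mul]; ring
    rw [this]
    calc _ ≤ ‖z ^ (n + 1)‖ + ‖z ^ 1‖ := by simpa using norm_sub_le (z ^ (n + 1)) z
      _ = 2 := by rw [hzn, hzn]; norm_num
  rw [hz, Complex.norm_exp_I_mul_ofReal_sub_one, norm_mul, Real.norm_eq_abs, Real.norm_eq_abs,
    abs_two] at h2
  linarith

/-- Stopping at `3π/2` keeps away from the zero of `sin(x/2)` at `x = 2π`, so that `|x| ≤ 3π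
|sin(x/2)|` on the whole range. -/
theorem norm_kern_mul_abs_le {n j : ℕ} {u : ℝ} (h1 : -π ≤ freq n j - u)
    (h2 : freq n j - u ≤ 3 * π / 2) : ‖kern n j u‖ * |freq n j - u| ≤ 3 * π := by
  set x := freq n j - u with hx
  have hpi := Real.pi_pos
  have key : |x| ≤ 3 * π * |Real.sin (x / 2)| := by
    rcases le_or_gt x π with h | h
    · have h3 : |x / 2| ≤ π / 2 := by rw [abs_le]; constructor <;> linarith
      have h4 := Real.mul_abs_le_abs_sin h3
      rw [abs_div, abs_two, div_mul_div_comm, div_le_iff₀ (by positivity)] at h4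
      nlinarith [abs_nonneg (Real.sin (x / 2))]
    · have h3 : |π - x / 2| ≤ π / 2 := by rw [abs_le]; constructor <;> linarith
      have h4 := Real.mul_abs_le_abs_sin h3
      rw [Real.sin_pi_sub, abs_of_nonneg (by linarith : 0 ≤ π - x / 2), div_mul_eq_mul_div,
        div_le_iff₀ hpi] at h4
      rw [abs_of_pos (by linarith)]
      nlinarith
  have h5 := norm_kern_mul_abs_sin_le n j u
  calc ‖kern n j u‖ * |x| ≤ ‖kern n j u‖ * (3 * π * |Real.sin (x / 2)|) :=
        mul_le_mul_of_nonneg_left key (norm_nonneg _)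
    _ = 3 * π * (‖kern n j u‖ * |Real.sin (x / 2)|) := by ring
    _ ≤ 3 * π * 1 := mul_le_mul_of_nonneg_left h5 (by positivity)
    _ = 3 * π := mul_one _

/-- By periodicity the kernel has another peak at `u = u_j - 2π`; here decay is measured from that
point. -/
theorem norm_kern_mul_wrap_le {n j : ℕ} {u : ℝ} (h1 : π ≤ freq n j - u)
    (h2 : freq n j - u ≤ 2 * π) : ‖kern n j u‖ * (2 * π - (freq n j - u)) ≤ π := by
  set x := freq n j - u with hx
  have hpi := Real.pi_pos
  have h3 : |π - x / 2| ≤ π / 2 := by rw [abs_le]; constructor <;> linarith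
  have h4 := Real.mul_abs_le_abs_sin h3
  rw [Real.sin_pi_sub, abs_of_nonneg (by linarith : 0 ≤ π - x / 2), div_mul_eq_mul_div,
    div_le_iff₀ hpi] at h4
  have h5 := norm_kern_mul_abs_sin_le n j u
  calc ‖kern n j u‖ * (2 * π - x) ≤ ‖kern n j u‖ * (π * |Real.sin (x / 2)|) :=
        mul_le_mul_of_nonneg_left (by linarith) (norm_nonneg _)
    _ = π * (‖kern n j u‖ * |Real.sin (x / 2)|) := by ring
    _ ≤ π * 1 := mul_le_mul_of_nonneg_left h5 hpi.le
    _ = π := mul_one _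

end Kernel

/-! ### Dominating functions and their integrals -/

section Dominating

/-- Dominating function away from the frequency. -/
noncomputable def farFun (d t : ℝ) : ℝ := (1 + |t| ^ (-(2 * d))) / (1 + |t|) ^ 2

theorem farFun_nonneg (d t : ℝ) : 0 ≤ farFun d t := by unfold farFun; positivity

theorem integrable_comp_abs_of_integrableOn {f : ℝ → ℝ} (hf : IntegrableOn f (Set.Ioi 0)) :
    Integrable fun x => f |x| := by
  have h1 : IntegrableOn (fun x => f |x|) (Set.Ioi 0) :=
    hf.congr_fun (fun x hx => by rw [abs_of_pos hx]) measurableSet_Ioi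
  have h2 : IntegrableOn (fun x ↦ f |x|) (Set.Iic 0) := by
    rw [← Measure.map_neg_eq_self (volume : Measure ℝ)]
    let m : MeasurableEmbedding fun x : ℝ => -x := (Homeomorph.neg ℝ).measurableEmbedding
    rw [m.integrableOn_map_iff]
    simp_rw [Function.comp_def, abs_neg, Set.neg_preimage, Set.neg_Iic, neg_zero]
    exact Iff.mpr integrableOn_Ici_iff_integrableOn_Ioi h1
  rw [← integrableOn_univ, ← Set.Iic_union_Ioi (a := (0 : ℝ))]
  exact h2.union h1

/-- Both halves of `|d| < 1/2` enter: `-2d > -1` for integrability at `0`, and `-2d - 2 < -1` at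
infinity. -/
theorem integrable_farFun {d : ℝ} (hd : |d| < 1 / 2) : Integrable (farFun d) := by
  obtain ⟨hd1, hd2⟩ := abs_lt.1 hd
  refine integrable_comp_abs_of_integrableOn (f := fun t => (1 + t ^ (-(2 * d))) / (1 + t) ^ 2) ?_
  have hmeas : Measurable fun t : ℝ => (1 + t ^ (-(2 * d))) / (1 + t) ^ 2 := by fun_prop
  rw [← Set.Ioc_union_Ioi_eq_Ioi zero_le_one]
  refine IntegrableOn.union ?_ ?_
  · have h1 : IntegrableOn (fun t : ℝ => 1 + t ^ (-(2 * d))) (Set.Ioc 0 1) := by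
      have := (intervalIntegral.intervalIntegrable_rpow' (a := 0) (b := 1)
        (by linarith : -1 < -(2 * d))).1
      exact (integrableOn_const (by simp)).add this
    refine h1.mono' hmeas.aestronglyMeasurable
      ((ae_restrict_iff' measurableSet_Ioc).2 (ae_of_all _ fun t ht => ?_))
    have ht0 : 0 < t := ht.1
    rw [Real.norm_of_nonneg (by positivity)]
    exact div_le_self (by positivity) (by nlinarith)
  · have h1 : IntegrableOn (fun t : ℝ => t ^ (-2 : ℝ) + t ^ (-(2 * d) - 2)) (Set.Ioi 1) :=
      (integrableOn_Ioi_rpow_of_lt (by norm_num) one_pos).add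
        (integrableOn_Ioi_rpow_of_lt (by linarith) one_pos)
    refine h1.mono' hmeas.aestronglyMeasurable
      ((ae_restrict_iff' measurableSet_Ioi).2 (ae_of_all _ fun t ht => ?_))
    have ht0 : 0 < t := one_pos.trans ht
    have h2 : t ^ (-2 : ℝ) = 1 / t ^ 2 := by
      rw [Real.rpow_neg ht0.le, Real.rpow_two, one_div]
    rw [Real.norm_of_nonneg (by positivity), Real.rpow_sub ht0, Real.rpow_two, h2, ← add_div]
    gcongr
    linarith

/-- The dominating function near the frequency `l`. -/
noncomputable def nearFun (l : ℝ) (w : ℝ → ℝ) (u : ℝ) : ℝ :=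
  (Set.Iic (l / 2)).indicator w |u - l|

theorem integral_nearFun {l : ℝ} (hl : 0 < l) {w : ℝ → ℝ} (hw : ContinuousOn w (Set.Icc 0 (l / 2))) :
    Integrable (nearFun l w) ∧ ∫ u, nearFun l w u = 2 * ∫ x in (0 : ℝ)..(l / 2), w x := by
  have h1 : IntegrableOn ((Set.Iic (l / 2)).indicator w) (Set.Ioi 0) := by
    rw [integrableOn_indicator_iff measurableSet_Iic]
    exact (hw.integrableOn_Icc).mono_set fun x hx => ⟨le_of_lt hx.2, hx.1⟩
  refine ⟨(integrable_comp_abs_of_integrableOn h1).comp_sub_right l, ?_⟩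
  have h2 := integral_sub_right_eq_self (μ := volume)
    (fun x : ℝ => (Set.Iic (l / 2)).indicator w |x|) l
  change ∫ u, (Set.Iic (l / 2)).indicator w |u - l| = _
  rw [h2, integral_comp_abs, setIntegral_indicator measurableSet_Iic, Set.Ioi_inter_Iic,
    intervalIntegral.integral_of_le (by linarith)]

theorem integral_inv_add {ε c : ℝ} (hε : 0 < ε) (hc : 0 ≤ c) :
    ∫ x in (0 : ℝ)..c, (ε + x)⁻¹ = Real.log (1 + c / ε) := by
  rw [intervalIntegral.integral_comp_add_left (fun x => x⁻¹), add_zero,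
    integral_inv_of_pos hε (by linarith)]
  congr 1; field_simp

theorem integral_wrap {y : ℝ} (hy : 0 < y) :
    IntegrableOn (fun u : ℝ => ((u + π + y) ^ 2)⁻¹) (Set.Icc (-π) π) ∧
    ∫ u in Set.Icc (-π) π, ((u + π + y) ^ 2)⁻¹ ≤ 1 / y := by
  have hpi := Real.pi_pos
  have hcont : ContinuousOn (fun u : ℝ => ((u + π + y) ^ 2)⁻¹) (Set.Icc (-π) π) := by
    refine ContinuousOn.inv₀ (by fun_prop) fun u hu => ?_
    have : 0 < u + π + y := by linarith [hu.1]
    positivity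
  refine ⟨hcont.integrableOn_Icc, ?_⟩
  have hder : ∀ u ∈ Set.uIcc (-π) π, HasDerivAt (fun u : ℝ => -(u + π + y)⁻¹)
      (((u + π + y) ^ 2)⁻¹) u := by
    intro u hu
    rw [Set.uIcc_of_le (by linarith)] at hu
    have h0 : u + π + y ≠ 0 := by linarith [hu.1]
    have h1 : HasDerivAt (fun u : ℝ => u + π + y) 1 u :=
      ((hasDerivAt_id u).add_const π).add_const y
    have h2 := (h1.inv h0).neg
    rwa [neg_div, neg_neg, one_div] at h2
  rw [integral_Icc_eq_integral_Ioc, ← intervalIntegral.integral_of_le (by linarith),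
    intervalIntegral.integral_eq_sub_of_hasDerivAt hder
      (by rw [intervalIntegrable_iff_integrableOn_Icc_of_le (by linarith)]
          exact hcont.integrableOn_Icc)]
  have h3 : 0 < (π + π + y)⁻¹ := by positivity
  have h4 : -π + π + y = y := by ring
  rw [h4, one_div]; linarith

end Dominating

/-! ### Relative error of the transfer function -/

section Transfer

/-- Power bounds on the transfer function and on its derivative. -/
structure TransferBounds (A : ℝ → ℂ) (d K₁ K₂ K₃ : ℝ) : Prop where
  pos : 0 < K₁
  lower : ∀ u ∈ Set.Ioo 0 π, K₁ * u ^ (-(2 * d)) ≤ ‖A u‖ ^ 2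
  upper : ∀ᵐ u, u ∈ Set.Ioo (-π) π → ‖A u‖ ^ 2 ≤ K₂ * |u| ^ (-(2 * d))
  differentiableOn : DifferentiableOn ℝ A (Set.Ioo 0 π)
  deriv_le : ∀ u ∈ Set.Ioo 0 π, ‖deriv A u‖ ≤ K₃ * u ^ (-1 - d)

variable {A : ℝ → ℂ} {d K₁ K₂ K₃ : ℝ}

theorem TransferBounds.nonneg (h : TransferBounds A d K₁ K₂ K₃) : 0 ≤ K₃ := by
  have hpi := Real.pi_pos
  have h1 := (norm_nonneg _).trans (h.deriv_le (π / 2) ⟨by linarith, by linarith⟩)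
  exact nonneg_of_mul_nonneg_left h1 (by positivity)

theorem TransferBounds.norm_lower (h : TransferBounds A d K₁ K₂ K₃) {l : ℝ}
    (hl : l ∈ Set.Ioo 0 π) : √K₁ * l ^ (-d) ≤ ‖A l‖ := by
  have hl0 : 0 < l := hl.1
  refine le_of_sq_le_sq ?_ (norm_nonneg _)
  rw [mul_pow, Real.sq_sqrt h.pos.le, ← Real.rpow_natCast (l ^ (-d)), ← Real.rpow_mul hl0.le]
  have h1 : -d * ((2 : ℕ) : ℝ) = -(2 * d) := by push_cast; ring
  rw [h1]
  exact h.lower l hl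

theorem TransferBounds.ne_zero (h : TransferBounds A d K₁ K₂ K₃) {l : ℝ}
    (hl : l ∈ Set.Ioo 0 π) : 0 < ‖A l‖ := by
  have hl0 : 0 < l := hl.1
  have := h.pos
  exact lt_of_lt_of_le (by positivity) (h.norm_lower hl)

/-- Mean value inequality. The segment stays above `l/2`, where the derivative is at most `4 K₃
l^(-1-d)`; dividing by `‖A l‖ ≥ √K₁ l^(-d)` cancels the singular power. -/
theorem TransferBounds.near (h : TransferBounds A d K₁ K₂ K₃) (hd : |d| < 1 / 2) {l u : ℝ}
    (hl : l ∈ Set.Ioo 0 π) (hu : u ∈ Set.Ioo 0 π) (hul : |u - l| ≤ l / 2) :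
    ‖A u / A l - 1‖ ≤ 4 * K₃ / √K₁ * (|u - l| / l) := by
  obtain ⟨hd1, hd2⟩ := abs_lt.1 hd
  have hl0 : 0 < l := hl.1
  have hAl := h.ne_zero hl
  have hmem : ∀ x ∈ Set.Ioo 0 π ∩ Set.Ici (l / 2), ‖deriv A x‖ ≤ 4 * K₃ * l ^ (-1 - d) := by
    rintro x ⟨hx, hx2⟩
    refine (h.deriv_le x hx).trans ?_
    have h1 : x ^ (-1 - d) ≤ (l / 2) ^ (-1 - d) :=
      Real.rpow_le_rpow_of_nonpos (by linarith) hx2 (by linarith)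
    have h2 : (l / 2) ^ (-1 - d) = l ^ (-1 - d) * 2 ^ (1 + d) := by
      rw [Real.div_rpow hl0.le (by norm_num), div_eq_mul_inv, ← Real.rpow_neg (by norm_num)]
      congr 2; ring
    have h3 : (2 : ℝ) ^ (1 + d) ≤ 4 := by
      calc (2 : ℝ) ^ (1 + d) ≤ 2 ^ (2 : ℝ) :=
            Real.rpow_le_rpow_of_exponent_le (by norm_num) (by linarith)
        _ = 4 := by norm_num
    have h4 : 0 < l ^ (-1 - d) := by positivity
    calc K₃ * x ^ (-1 - d) ≤ K₃ * (l ^ (-1 - d) * 4) :=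
          mul_le_mul_of_nonneg_left (h1.trans (h2.le.trans (by gcongr))) h.nonneg
      _ = _ := by ring
  have hconv : Convex ℝ (Set.Ioo 0 π ∩ Set.Ici (l / 2)) := (convex_Ioo 0 π).inter (convex_Ici _)
  have hdiff := Convex.norm_image_sub_le_of_norm_deriv_le
    (fun x hx => (h.differentiableOn x hx.1).differentiableAt (isOpen_Ioo.mem_nhds hx.1)) hmem hconv
    (x := l) (y := u) ⟨hl, by simp; linarith⟩ ⟨hu, by
      simp only [Set.mem_Ici]; linarith [(abs_le.1 hul).1]⟩
  have hne : A l ≠ 0 := norm_pos_iff.1 hAl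
  rw [div_sub_one hne, norm_div, div_le_iff₀ hAl]
  refine hdiff.trans ?_
  rw [Real.norm_eq_abs]
  have hK := Real.sqrt_pos.2 h.pos
  have h5 : l ^ (-1 - d) = l ^ (-d) / l := by
    rw [show -1 - d = -d - 1 by ring, Real.rpow_sub_one hl0.ne']
  calc 4 * K₃ * l ^ (-1 - d) * |u - l|
      = 4 * K₃ / √K₁ * (|u - l| / l) * (√K₁ * l ^ (-d)) := by rw [h5]; field_simp
    _ ≤ _ := by
      refine mul_le_mul_of_nonneg_left (h.norm_lower hl) ?_
      have := h.nonneg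
      positivity

/-- The quotient of the two power bounds depends only on `u / l`, which allows rescaling later. It
holds almost everywhere because the upper bound does. -/
theorem TransferBounds.far (h : TransferBounds A d K₁ K₂ K₃) {l : ℝ} (hl : l ∈ Set.Ioo 0 π) :
    ∀ᵐ u, u ∈ Set.Ioo (-π) π → ‖A u / A l‖ ^ 2 ≤ |K₂| / K₁ * |u / l| ^ (-(2 * d)) := by
  have hl0 : 0 < l := hl.1
  filter_upwards [h.upper] with u hu hmem
  have h1 := h.pos
  have h2 := h.lower l hl
  have h3 := hu hmem
  have hA := h.ne_zero hl
  rw [norm_div, div_pow, div_le_iff₀ (by positivity), abs_div, abs_of_pos hl0,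
    Real.div_rpow (abs_nonneg _) hl0.le]
  have h4 : 0 < l ^ (-(2 * d)) := by positivity
  have h5 : 0 ≤ |u| ^ (-(2 * d)) := by positivity
  calc ‖A u‖ ^ 2 ≤ |K₂| * |u| ^ (-(2 * d)) :=
        h3.trans (mul_le_mul_of_nonneg_right (le_abs_self _) h5)
    _ = |K₂| / K₁ * (|u| ^ (-(2 * d)) / l ^ (-(2 * d))) * (K₁ * l ^ (-(2 * d))) := by
        field_simp
    _ ≤ _ := mul_le_mul_of_nonneg_left h2 (by positivity)

end Transfer

/-! ### Uniform bounds for the errors at each frequency -/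

section ErrorBounds

variable {A : ℝ → ℂ} {d K₁ K₂ K₃ : ℝ}

theorem rpow_le_two {r s : ℝ} (hr1 : 1 / 2 ≤ r) (hr2 : r ≤ 2) (hs : |s| ≤ 1) : r ^ s ≤ 2 := by
  obtain ⟨hs1, hs2⟩ := abs_le.1 hs
  have hr : 0 < r := by linarith
  rcases le_or_gt 0 s with h | h
  · calc r ^ s ≤ 2 ^ s := Real.rpow_le_rpow hr.le hr2 h
      _ ≤ 2 ^ (1 : ℝ) := Real.rpow_le_rpow_of_exponent_le (by norm_num) hs2
      _ = 2 := Real.rpow_one 2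
  · calc r ^ s ≤ (1 / 2) ^ s := Real.rpow_le_rpow_of_nonpos (by norm_num) hr1 h.le
      _ = 2 ^ (-s) := by rw [one_div, Real.inv_rpow (by norm_num), Real.rpow_neg (by norm_num)]
      _ ≤ 2 ^ (1 : ℝ) := Real.rpow_le_rpow_of_exponent_le (by norm_num) (by linarith)
      _ = 2 := Real.rpow_one 2

/-- Pointwise bound of the weighted kernel away from the frequency. -/
theorem kern_sq_mul_far_le {n j : ℕ} {K u v : ℝ} (hd : |d| < 1 / 2) (hK : 0 ≤ K)
    (hl : freq n j ∈ Set.Ioo 0 π) (hu : u ∈ Set.Ioo (-π) π)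
    (hfar : freq n j / 2 < |u - freq n j|)
    (hv : v ≤ 2 + 2 * (K * |u / freq n j| ^ (-(2 * d)))) :
    ‖kern n j u‖ ^ 2 * v ≤ 225 * π ^ 2 * (2 + 2 * K) / freq n j ^ 2 * farFun d (u / freq n j)
      + π ^ 2 * (2 + 4 * K) * ((u + π + (π - freq n j)) ^ 2)⁻¹ := by
  have hpi := Real.pi_pos
  set l := freq n j with hldef
  obtain ⟨hl0, hl1⟩ := hl
  obtain ⟨hu0, hu1⟩ := hu
  have hpow : 0 ≤ |u / l| ^ (-(2 * d)) := by positivity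
  have hy : 0 < u + π + (π - l) := by linarith
  -- The first range is governed by the peak at `l`. There `|u - l| > l/2` gives `l + |u| ≤ 5 |l -
  -- u|`, so the kernel is at most `15π/(l + |u|)`, whence `225 = 15²`. The second range is governed
  -- by the peak at `l - 2π`.
  rcases le_or_gt (l - u) (3 * π / 2) with hx | hx
  · have h1 : ‖kern n j u‖ * |l - u| ≤ 3 * π :=
      norm_kern_mul_abs_le (by linarith) (by linarith)
    rw [abs_sub_comm] at hfar
    have h2 : l + |u| ≤ 5 * |l - u| := by
      have : |u| ≤ |l - u| + l := by
        calc |u| = |l - (l - u)| := by congr 1; ring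
          _ ≤ |l| + |l - u| := abs_sub _ _
          _ = |l - u| + l := by rw [abs_of_pos hl0]; ring
      linarith
    have h3 : ‖kern n j u‖ * (l + |u|) ≤ 15 * π :=
      calc ‖kern n j u‖ * (l + |u|) ≤ ‖kern n j u‖ * (5 * |l - u|) :=
            mul_le_mul_of_nonneg_left h2 (norm_nonneg _)
        _ = 5 * (‖kern n j u‖ * |l - u|) := by ring
        _ ≤ _ := by linarith
    have h4 : ‖kern n j u‖ ^ 2 ≤ 225 * π ^ 2 / (l + |u|) ^ 2 := by
      rw [le_div_iff₀ (by positivity), ← mul_pow]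
      calc _ ≤ (15 * π) ^ 2 := pow_le_pow_left₀ (by positivity) h3 2
        _ = _ := by ring
    have h5 : v ≤ (2 + 2 * K) * (1 + |u / l| ^ (-(2 * d))) := by nlinarith
    have h6 : (l + |u|) ^ 2 = l ^ 2 * (1 + |u / l|) ^ 2 := by
      rw [abs_div, abs_of_pos hl0, ← mul_pow]; congr 1; field_simp
    calc ‖kern n j u‖ ^ 2 * v
        ≤ ‖kern n j u‖ ^ 2 * ((2 + 2 * K) * (1 + |u / l| ^ (-(2 * d)))) :=
          mul_le_mul_of_nonneg_left h5 (by positivity)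
      _ ≤ 225 * π ^ 2 / (l + |u|) ^ 2 * ((2 + 2 * K) * (1 + |u / l| ^ (-(2 * d)))) :=
          mul_le_mul_of_nonneg_right h4 (by positivity)
      _ = 225 * π ^ 2 * (2 + 2 * K) / l ^ 2 * farFun d (u / l) := by
          rw [h6, farFun]; field_simp
      _ ≤ _ := le_add_of_nonneg_right (by positivity)
  · have h1 : ‖kern n j u‖ * (2 * π - (l - u)) ≤ π :=
      norm_kern_mul_wrap_le (by linarith) (by linarith)
    have h2 : ‖kern n j u‖ ^ 2 ≤ π ^ 2 * ((u + π + (π - l)) ^ 2)⁻¹ := by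
      rw [← div_eq_mul_inv, le_div_iff₀ (by positivity), ← mul_pow]
      refine pow_le_pow_left₀ (by positivity) ?_ 2
      rw [show u + π + (π - l) = 2 * π - (l - u) by ring]
      exact h1
    -- As `l - u > 3π/2` with `l` and `|u|` below `π`, both exceed `π/2`; their ratio lies in `[1/2,
    -- 2]`.
    have h3 : |u / l| ^ (-(2 * d)) ≤ 2 := by
      rw [abs_div, abs_of_pos hl0, abs_of_neg (by linarith)]
      refine rpow_le_two ?_ ?_ ?_
      · rw [div_le_div_iff₀ (by norm_num) hl0]; linarith
      · rw [div_le_iff₀ hl0]; linarith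
      · rw [abs_neg, abs_mul, abs_two]; linarith
    have h4 : v ≤ 2 + 4 * K := by nlinarith
    calc ‖kern n j u‖ ^ 2 * v ≤ ‖kern n j u‖ ^ 2 * (2 + 4 * K) :=
          mul_le_mul_of_nonneg_left h4 (by positivity)
      _ ≤ π ^ 2 * ((u + π + (π - l)) ^ 2)⁻¹ * (2 + 4 * K) :=
          mul_le_mul_of_nonneg_right h2 (by positivity)
      _ = π ^ 2 * (2 + 4 * K) * ((u + π + (π - l)) ^ 2)⁻¹ := by ring
      _ ≤ _ := le_add_of_nonneg_left (by have := farFun_nonneg d (u / l); positivity)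

/-- Integral bound: the near part is controlled by `w`, the far part by the power bounds. -/
theorem TransferBounds.integral_kern_sq_mul_le (h : TransferBounds A d K₁ K₂ K₃)
    (hd : |d| < 1 / 2) {n j : ℕ} (hl : freq n j ∈ Set.Ioo 0 π) {V w : ℝ → ℝ} (hV0 : ∀ u, 0 ≤ V u)
    (hV : ∀ u, V u ≤ 2 + 2 * ‖A u / A (freq n j)‖ ^ 2)
    (hw : ContinuousOn w (Set.Icc 0 (freq n j / 2))) (hw0 : ∀ x, 0 ≤ x → 0 ≤ w x)
    (hnear : ∀ u ∈ Set.Ioo 0 π, |u - freq n j| ≤ freq n j / 2 →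
      ‖kern n j u‖ ^ 2 * V u ≤ w |u - freq n j|) :
    ∫ u in Set.Icc (-π) π, ‖kern n j u‖ ^ 2 * V u ≤ 2 * (∫ x in (0 : ℝ)..(freq n j / 2), w x)
      + 225 * π ^ 2 * (2 + 2 * (|K₂| / K₁)) * (∫ t, farFun d t) / freq n j
      + π ^ 2 * (2 + 4 * (|K₂| / K₁)) / (π - freq n j) := by
  have hpi := Real.pi_pos
  set l := freq n j with hldef
  have hl0 : 0 < l := hl.1
  have hl1 : 0 < π - l := by linarith [hl.2]
  have hK1 := h.pos
  set K := |K₂| / K₁ with hKdef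
  have hK : 0 ≤ K := by positivity
  set c₂ := 225 * π ^ 2 * (2 + 2 * K) with hc₂
  set c₃ := π ^ 2 * (2 + 4 * K) with hc₃
  have hc₂0 : 0 ≤ c₂ := by positivity
  have hc₃0 : 0 ≤ c₃ := by positivity
  obtain ⟨hni, hnint⟩ := integral_nearFun hl0 hw
  have hfi : Integrable fun u => c₂ / l ^ 2 * farFun d (u / l) :=
    ((integrable_farFun hd).comp_div hl0.ne').const_mul _
  obtain ⟨hwi, hwint⟩ := integral_wrap hl1
  have hwi' : IntegrableOn (fun u => c₃ * ((u + π + (π - l)) ^ 2)⁻¹) (Set.Icc (-π) π) :=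
    hwi.const_mul _
  have hn0 : ∀ u, 0 ≤ nearFun l w u := fun u =>
    Set.indicator_apply_nonneg fun _ => hw0 _ (abs_nonneg _)
  have hf0 : ∀ u, 0 ≤ c₂ / l ^ 2 * farFun d (u / l) := fun u =>
    mul_nonneg (by positivity) (farFun_nonneg _ _)
  have hsum : IntegrableOn (fun u => nearFun l w u + c₂ / l ^ 2 * farFun d (u / l))
    (Set.Icc (-π) π) := hni.integrableOn.add hfi.integrableOn
  have hle : ∫ u in Set.Icc (-π) π, ‖kern n j u‖ ^ 2 * V u ≤ ∫ u in Set.Icc (-π) π,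
      (nearFun l w u + c₂ / l ^ 2 * farFun d (u / l) + c₃ * ((u + π + (π - l)) ^ 2)⁻¹) := by
    rw [integral_Icc_eq_integral_Ioo, integral_Icc_eq_integral_Ioo]
    refine integral_mono_of_nonneg (ae_of_all _ fun u => mul_nonneg (by positivity) (hV0 u))
      ((hsum.add hwi').mono_set Set.Ioo_subset_Icc_self) ?_
    refine (ae_restrict_iff' measurableSet_Ioo).2 ?_
    filter_upwards [h.far hl] with u hfar hu
    have hwr : 0 ≤ c₃ * ((u + π + (π - l)) ^ 2)⁻¹ := by positivity
    rcases le_or_gt |u - l| (l / 2) with hc | hc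
    -- The near region lies above `l/2 > 0`, hence inside `(0, π)`, the interval on which `A` has a
    -- derivative bound.
    · have h1 : u ∈ Set.Ioo 0 π := ⟨by linarith [(abs_le.1 hc).1], hu.2⟩
      have h2 : nearFun l w u = w |u - l| := Set.indicator_of_mem (Set.mem_Iic.2 hc) _
      rw [h2]
      linarith [hnear u h1 hc, hf0 u]
    · have h3 := kern_sq_mul_far_le hd hK hl hu hc (v := V u)
        ((hV u).trans (by linarith [hfar hu]))
      linarith [hn0 u]
  refine hle.trans ?_
  rw [integral_add hsum hwi', integral_add hni.integrableOn hfi.integrableOn,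
    integral_const_mul c₃]
  have h1 : ∫ u in Set.Icc (-π) π, nearFun l w u ≤ 2 * ∫ x in (0 : ℝ)..(l / 2), w x := by
    rw [← hnint]
    exact setIntegral_le_integral hni (ae_of_all _ hn0)
  -- The substitution `t = u / l` turns `l⁻²` into `l⁻¹`, uniformly in the frequency.
  have h2 : ∫ u in Set.Icc (-π) π, c₂ / l ^ 2 * farFun d (u / l) ≤ c₂ * (∫ t, farFun d t) / l := by
    refine (setIntegral_le_integral hfi (ae_of_all _ hf0)).trans (le_of_eq ?_)
    rw [integral_const_mul, Measure.integral_comp_div, abs_of_pos hl0, smul_eq_mul]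
    field_simp
  have h3 : c₃ * ∫ u in Set.Icc (-π) π, ((u + π + (π - l)) ^ 2)⁻¹ ≤ c₃ / (π - l) := by
    rw [div_eq_mul_one_div]
    exact mul_le_mul_of_nonneg_left hwint hc₃0
  linarith

theorem freq_mem {n j : ℕ} (hj : j ∈ Finset.Icc 1 (nu n)) : freq n j ∈ Set.Ioo 0 π := by
  have hpi := Real.pi_pos
  simp only [Finset.mem_Icc, nu] at hj
  have h1 : (0 : ℝ) < j := by exact_mod_cast hj.1
  have h2 : (0 : ℝ) < n := by exact_mod_cast (by omega : 0 < n)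
  have h3 : 2 * (j : ℝ) < n := by exact_mod_cast (by omega : 2 * j < n)
  refine ⟨by unfold freq; positivity, ?_⟩
  rw [freq, div_lt_iff₀ h2]
  nlinarith

/-- The distance `π - u_j` is `π(n - 2j)/n`. The `-1` in `nu` keeps the natural number `n / 2 - j`
positive. -/
theorem wrap_freq_le {n j : ℕ} (hj : j ∈ Finset.Icc 1 (nu n)) :
    (2 * π * n)⁻¹ * (1 / (π - freq n j)) ≤ 1 / ((n / 2 - j : ℕ) : ℝ) := by
  have hpi := Real.pi_gt_three
  have hl := freq_mem hj
  simp only [Finset.mem_Icc, nu] at hj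
  have h2 : (0 : ℝ) < n := by exact_mod_cast (by omega : 0 < n)
  have h4 : (0 : ℝ) < ((n / 2 - j : ℕ) : ℝ) := by exact_mod_cast (by omega : 0 < n / 2 - j)
  have h5 : 2 * ((n / 2 - j : ℕ) : ℝ) ≤ n - 2 * j := by
    have : 2 * (n / 2 - j) + 2 * j ≤ n := by omega
    have : 2 * ((n / 2 - j : ℕ) : ℝ) + 2 * j ≤ n := by exact_mod_cast this
    linarith
  have h6 : 2 * π * n * (π - freq n j) = 2 * π ^ 2 * (n - 2 * j) := by
    rw [freq]; field_simp
  rw [inv_eq_one_div, div_mul_div_comm, one_mul, h6]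
  refine one_div_le_one_div_of_le h4 ?_
  have hpp : 1 ≤ π ^ 2 := by nlinarith
  have := mul_le_mul_of_nonneg_right hpp (by linarith : (0 : ℝ) ≤ n - 2 * j)
  linarith

theorem inv_freq_le {n j : ℕ} (hj : j ∈ Finset.Icc 1 (nu n)) :
    (2 * π * n)⁻¹ * (1 / freq n j) ≤ 1 / (j : ℝ) := by
  have hpi := Real.pi_gt_three
  simp only [Finset.mem_Icc, nu] at hj
  have h1 : (0 : ℝ) < j := by exact_mod_cast hj.1
  have h2 : (0 : ℝ) < n := by exact_mod_cast (by omega : 0 < n)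
  have h6 : 2 * π * n * freq n j = 4 * π ^ 2 * j := by
    rw [freq]; field_simp; ring
  rw [inv_eq_one_div, div_mul_div_comm, one_mul, h6]
  refine one_div_le_one_div_of_le h1 ?_
  have hpp : 1 ≤ π ^ 2 := by nlinarith
  have := mul_le_mul_of_nonneg_right hpp h1.le
  linarith

/-- A common majorant for first and second power, so that one far estimate serves both errors. -/
theorem norm_sub_one_le (z : ℂ) : ‖z - 1‖ ≤ 2 + 2 * ‖z‖ ^ 2 ∧ ‖z - 1‖ ^ 2 ≤ 2 + 2 * ‖z‖ ^ 2 := by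
  have h1 : ‖z - 1‖ ≤ ‖z‖ + 1 := by simpa using norm_sub_le z 1
  have h2 := norm_nonneg z
  have h3 := norm_nonneg (z - 1)
  constructor
  · nlinarith [sq_nonneg (‖z‖ - 1)]
  · nlinarith [sq_nonneg (‖z‖ - 1)]

set_option maxHeartbeats 800000 in
/-- Bounds, uniform in the frequency, for the two relative errors of the transfer function. -/
theorem TransferBounds.exists_err_le (h : TransferBounds A d K₁ K₂ K₃) (hd : |d| < 1 / 2) :
    ∃ C : ℝ, 0 < C ∧ ∀ n : ℕ, ∀ j ∈ Finset.Icc 1 (nu n),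
      sqErr n j (fun u => A u / A (freq n j) - 1) ≤ C * (1 / j + 1 / ((n / 2 - j : ℕ) : ℝ)) ∧
      ‖meanErr n j (fun u => A u / A (freq n j) - 1)‖
        ≤ C * ((1 + Real.log j) / j + 1 / ((n / 2 - j : ℕ) : ℝ)) := by
  have hpi := Real.pi_gt_three
  have hK1 := h.pos
  have hK3 := h.nonneg
  set c₂ := 225 * π ^ 2 * (2 + 2 * (|K₂| / K₁)) * (∫ t, farFun d t) with hc₂
  set c₃ := π ^ 2 * (2 + 4 * (|K₂| / K₁)) with hc₃
  have hI : 0 ≤ ∫ t, farFun d t := integral_nonneg (farFun_nonneg d)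
  have hc₂0 : 0 ≤ c₂ := by positivity
  have hc₃0 : 0 ≤ c₃ := by positivity
  set K₄ := 4 * K₃ / √K₁ with hK₄
  have hK₄0 : 0 ≤ K₄ := by positivity
  obtain ⟨k₁, hk₁⟩ : ∃ k, k = 9 * π ^ 2 * K₄ ^ 2 := ⟨_, rfl⟩
  obtain ⟨k₂, hk₂⟩ : ∃ k, k = 4 * K₄ * (3 * π + 9 * π ^ 2) := ⟨_, rfl⟩
  have hk₁0 : 0 ≤ k₁ := by rw [hk₁]; positivity
  have hk₂0 : 0 ≤ k₂ := by rw [hk₂]; positivity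
  obtain ⟨E, hE⟩ : ∃ E, E = k₁ + k₂ + c₂ + c₃ + 1 := ⟨_, rfl⟩
  refine ⟨E, by rw [hE]; positivity, fun n j hj => ?_⟩
  have hl := freq_mem hj
  have hinv := inv_freq_le hj
  have hwrap := wrap_freq_le hj
  obtain ⟨hj1, hj2⟩ := Finset.mem_Icc.1 hj
  rw [nu] at hj2
  have hjpos : (1 : ℝ) ≤ j := by exact_mod_cast hj1
  have hn : (0 : ℝ) < n := by exact_mod_cast (by omega : 0 < n)
  set l := freq n j with hldef
  have hl0 : 0 < l := hl.1
  have hl1 : 0 < π - l := by linarith [hl.2]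
  have hm : (0 : ℝ) < ((n / 2 - j : ℕ) : ℝ) := by exact_mod_cast (by omega : 0 < n / 2 - j)
  have hlog : 0 ≤ Real.log j := Real.log_nonneg hjpos
  have hker : ∀ u ∈ Set.Ioo 0 π, |u - l| ≤ l / 2 → ‖kern n j u‖ * |u - l| ≤ 3 * π := by
    intro u hu hul
    have := abs_le.1 hul
    rw [abs_sub_comm]
    exact norm_kern_mul_abs_le (by linarith [hu.2]) (by linarith [hl.2])
  constructor
  -- The squared relative error cancels the kernel's `|u - l|⁻²`. The integrand is `O(l⁻²)` on an
  -- interval of length `l`, and no logarithm appears.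
  · have hb := h.integral_kern_sq_mul_le hd hl (V := fun u => ‖A u / A l - 1‖ ^ 2)
      (w := fun _ => 9 * π ^ 2 * K₄ ^ 2 / l ^ 2) (fun u => by positivity)
      (fun u => (norm_sub_one_le _).2) continuousOn_const (fun x _ => by positivity)
      (fun u hu hul => by
        have h1 := h.near hd hl hu hul
        calc ‖kern n j u‖ ^ 2 * ‖A u / A l - 1‖ ^ 2
            ≤ ‖kern n j u‖ ^ 2 * (K₄ * (|u - l| / l)) ^ 2 := by gcongr
          _ = (‖kern n j u‖ * |u - l|) ^ 2 * (K₄ ^ 2 / l ^ 2) := by field_simp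
          _ ≤ (3 * π) ^ 2 * (K₄ ^ 2 / l ^ 2) :=
              mul_le_mul_of_nonneg_right (pow_le_pow_left₀ (by positivity) (hker u hu hul) 2)
                (by positivity)
          _ = _ := by ring)
    rw [intervalIntegral.integral_const, smul_eq_mul] at hb
    have h2 : 2 * ((l / 2 - 0) * (9 * π ^ 2 * K₄ ^ 2 / l ^ 2)) = k₁ * (1 / l) := by
      rw [hk₁]; field_simp; ring
    rw [h2] at hb
    rw [sqErr]
    calc _ ≤ (2 * π * n)⁻¹ * (k₁ * (1 / l) + c₂ / l + c₃ / (π - l)) :=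
          mul_le_mul_of_nonneg_left hb (by positivity)
      _ = (k₁ + c₂) * ((2 * π * n)⁻¹ * (1 / l))
          + c₃ * ((2 * π * n)⁻¹ * (1 / (π - l))) := by ring
      _ ≤ E * (1 / j) + E * (1 / ((n / 2 - j : ℕ) : ℝ)) :=
          add_le_add (mul_le_mul (by linarith) hinv (by positivity) (by linarith))
            (mul_le_mul (by linarith) hwrap (by positivity) (by linarith))
      _ = _ := by ring
  -- Only one power of `|u - l|` is gained. Using both `‖kern‖ ≤ n` and `‖kern‖ ≤ 3π/|u - l|` leaves
  -- `(1/n + |u - l|)⁻¹`, whose integral is `log(1 + nl/2) = log(1 + πj)`: the source of the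
  -- logarithm.
  · have hb := h.integral_kern_sq_mul_le hd hl (V := fun u => ‖A u / A l - 1‖)
      (w := fun x => K₄ * (3 * π + 9 * π ^ 2) / l * (1 / n + x)⁻¹) (fun u => by positivity)
      (fun u => (norm_sub_one_le _).1)
      (ContinuousOn.mul continuousOn_const (ContinuousOn.inv₀ (by fun_prop) fun x hx => by
        have : (0 : ℝ) < 1 / n := by positivity
        linarith [hx.1])) (fun x _ => by positivity)
      (fun u hu hul => by
        have h1 := h.near hd hl hu hul
        have h3 := hker u hu hul
        have h4 := norm_kern_le n j u
        have h5 : 0 < 1 / (n : ℝ) + |u - l| := by positivity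
        have h6 : ‖kern n j u‖ ^ 2 * |u - l| * (1 / n + |u - l|) ≤ 3 * π + 9 * π ^ 2 := by
          have h7 : ‖kern n j u‖ * (1 / n) ≤ 1 := by
            rw [mul_one_div, div_le_one hn]; exact h4
          calc _ = (‖kern n j u‖ * (1 / n)) * (‖kern n j u‖ * |u - l|)
                + (‖kern n j u‖ * |u - l|) ^ 2 := by ring
            _ ≤ 1 * (3 * π) + (3 * π) ^ 2 := by gcongr
            _ = _ := by ring
        calc ‖kern n j u‖ ^ 2 * ‖A u / A l - 1‖
            ≤ ‖kern n j u‖ ^ 2 * (K₄ * (|u - l| / l)) := by gcongr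
          _ = K₄ / l * (‖kern n j u‖ ^ 2 * |u - l| * (1 / n + |u - l|)) * (1 / n + |u - l|)⁻¹ := by
              field_simp
          _ ≤ K₄ / l * (3 * π + 9 * π ^ 2) * (1 / n + |u - l|)⁻¹ := by gcongr
          _ = _ := by ring)
    rw [intervalIntegral.integral_const_mul, integral_inv_add (by positivity) (by positivity)] at hb
    have hL : Real.log (1 + l / 2 / (1 / n)) ≤ 2 * (1 + Real.log j) := by
      have h7 : l / 2 / (1 / n) = π * j := by rw [hldef, freq]; field_simp
      have h8 : (1 : ℝ) + π * j ≤ Real.exp 2 * j := by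
        have h9 : (5 : ℝ) ≤ Real.exp 2 := by
          have := Real.exp_one_gt_d9
          have h10 : Real.exp 2 = Real.exp 1 * Real.exp 1 := by rw [← Real.exp_add]; norm_num
          nlinarith
        nlinarith [Real.pi_lt_four]
      rw [h7]
      calc Real.log (1 + π * j) ≤ Real.log (Real.exp 2 * j) :=
            Real.log_le_log (by positivity) h8
        _ = 2 + Real.log j := by
            rw [Real.log_mul (Real.exp_pos 2).ne' (by positivity), Real.log_exp]
        _ ≤ _ := by linarith
    have hnorm : ‖meanErr n j (fun u => A u / A l - 1)‖ ≤
        (2 * π * n)⁻¹ * ∫ u in Set.Icc (-π) π, ‖kern n j u‖ ^ 2 * ‖A u / A l - 1‖ := by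
      rw [meanErr, norm_mul, Complex.norm_real, Real.norm_of_nonneg (by positivity)]
      refine mul_le_mul_of_nonneg_left ((norm_integral_le_integral_norm _).trans (le_of_eq ?_))
        (by positivity)
      refine integral_congr_ae (ae_of_all _ fun u => ?_)
      simp only [norm_mul, RCLike.norm_conj, Complex.norm_real, norm_pow, norm_norm]
    have h11 : 2 * (K₄ * (3 * π + 9 * π ^ 2) / l * Real.log (1 + l / 2 / (1 / n)))
        ≤ k₂ * (1 + Real.log j) * (1 / l) := by
      calc _ ≤ 2 * (K₄ * (3 * π + 9 * π ^ 2) / l * (2 * (1 + Real.log j))) := by gcongr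
        _ = _ := by rw [hk₂]; ring
    have h12 : k₂ * (1 + Real.log j) + c₂ ≤ E * (1 + Real.log j) := by
      have h13 : c₂ ≤ c₂ * (1 + Real.log j) := le_mul_of_one_le_right hc₂0 (by linarith)
      have h14 : (k₂ + c₂) * (1 + Real.log j) ≤ E * (1 + Real.log j) :=
        mul_le_mul_of_nonneg_right (by linarith) (by linarith)
      linarith
    calc _ ≤ (2 * π * n)⁻¹ * (k₂ * (1 + Real.log j) * (1 / l) + c₂ / l + c₃ / (π - l)) :=
          hnorm.trans (mul_le_mul_of_nonneg_left
            (hb.trans (add_le_add (add_le_add h11 le_rfl) le_rfl)) (by positivity))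
      _ = (k₂ * (1 + Real.log j) + c₂) * ((2 * π * n)⁻¹ * (1 / l))
          + c₃ * ((2 * π * n)⁻¹ * (1 / (π - l))) := by ring
      _ ≤ (E * (1 + Real.log j)) * (1 / j) + E * (1 / ((n / 2 - j : ℕ) : ℝ)) :=
          add_le_add (mul_le_mul h12 hinv (by positivity)
              (mul_nonneg (by linarith) (by linarith)))
            (mul_le_mul (by linarith) hwrap (by positivity) (by linarith))
      _ = _ := by ring

end ErrorBounds

/-! ### From the hypotheses to power bounds -/

section Hypotheses

variable {Ω : Type*} [MeasurableSpace Ω] {P : Measure Ω}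

theorem IsIIDStandardized.standardizedFourth {ζ : ℤ → Ω → ℝ} (hζ : IsIIDStandardized P ζ)
    (hζ4 : Integrable (fun ω => (ζ 0 ω) ^ 4) P) :
    StandardizedFourth P ζ (∫ ω, (ζ 0 ω) ^ 4 ∂P) where
  indep := hζ.indep
  memLp i := by
    rw [(hζ.identDistrib i).memLp_iff,
      ← integrable_norm_rpow_iff hζ.memLp.aestronglyMeasurable (by norm_num) (by norm_num)]
    refine hζ4.congr (ae_of_all _ fun ω => ?_)
    have h4 : ((4 : ENNReal).toReal) = ((4 : ℕ) : ℝ) := by norm_num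
    simp only [h4, Real.rpow_natCast, Real.norm_eq_abs]
    rw [← abs_pow, abs_of_nonneg (by positivity)]
  mean i := by rw [(hζ.identDistrib i).integral_eq, hζ.mean]
  variance i := by
    rw [← hζ.variance]
    exact ((hζ.identDistrib i).comp (measurable_id.pow_const 2)).integral_eq
  fourth i := le_of_eq
    ((hζ.identDistrib i).comp (measurable_id.pow_const 4)).integral_eq

/-- The spectral and transfer conditions give power bounds on the transfer function, and the
spectral identity holds pointwise on `(0, π)`. -/
theorem exists_transferBounds {A : ℝ → ℂ} {f : ℝ → ℝ} {d : ℝ}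
    (hae : ∀ᵐ u, u ∈ Set.Ioo (-π) π → ‖A u‖ ^ 2 = 2 * π * f u)
    (hfd : SpectralCondition f d) (hAd : TransferCondition A d) :
    (∀ u ∈ Set.Ioo 0 π, ‖A u‖ ^ 2 = 2 * π * f u) ∧
      ∃ K₁ K₂ K₃ : ℝ, TransferBounds A d K₁ K₂ K₃ := by
  have hpi := Real.pi_pos
  obtain ⟨g, hg, ⟨C₁, C₂, hC₁, hC⟩, hfg⟩ := hfd
  obtain ⟨hdiff, C', hC'⟩ := hAd
  have hsub : Set.Ioo 0 π ⊆ Set.Icc (-π) π := fun u hu => ⟨by linarith [hu.1], hu.2.le⟩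
  have hcf : ContinuousOn f (Set.Ioo 0 π) := by
    have h1 : ContinuousOn (fun u : ℝ => |u| ^ (-(2 * d)) * g u) (Set.Ioo 0 π) := by
      refine ContinuousOn.mul (fun u hu => ?_) (hg.mono hsub)
      have h2 : |u| ≠ 0 := abs_ne_zero.2 hu.1.ne'
      exact (ContinuousAt.rpow_const continuous_abs.continuousAt (Or.inl h2)).continuousWithinAt
    exact h1.congr fun u hu => hfg u (hsub hu) hu.1.ne'
  -- The spectral identity is needed at the Fourier frequencies themselves. It extends from almost
  -- everywhere to everywhere because both sides are continuous on `(0, π)`.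
  have hpt : ∀ u ∈ Set.Ioo 0 π, ‖A u‖ ^ 2 = 2 * π * f u := by
    refine Measure.eqOn_open_of_ae_eq (μ := volume) ?_ isOpen_Ioo (hdiff.continuousOn.norm.pow 2)
      (continuousOn_const.mul hcf)
    refine (ae_restrict_iff' measurableSet_Ioo).2 ?_
    filter_upwards [hae] with u hu hmem
    exact hu ⟨by linarith [hmem.1], hmem.2⟩
  refine ⟨hpt, 2 * π * C₁, 2 * π * C₂, C', by positivity, fun u hu => ?_, ?_, hdiff, hC'⟩
  · have hu0 : 0 < u := hu.1
    rw [hpt u hu, hfg u (hsub hu) hu.1.ne', abs_of_pos hu0]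
    have h1 := (hC u (hsub hu)).1
    have h2 : 0 < u ^ (-(2 * d)) := by positivity
    calc 2 * π * C₁ * u ^ (-(2 * d)) = 2 * π * (u ^ (-(2 * d)) * C₁) := by ring
      _ ≤ _ := by gcongr
  · have h0 : ∀ᵐ u : ℝ, u ≠ 0 := by
      simp [ae_iff]
    filter_upwards [hae, h0] with u hu hne hmem
    have hmem' : u ∈ Set.Icc (-π) π := Set.Ioo_subset_Icc_self hmem
    rw [hu hmem, hfg u hmem' hne]
    have h1 := (hC u hmem').2
    have h2 : 0 ≤ |u| ^ (-(2 * d)) := by positivity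
    calc 2 * π * (|u| ^ (-(2 * d)) * g u) ≤ 2 * π * (|u| ^ (-(2 * d)) * C₂) := by gcongr
      _ = _ := by ring

end Hypotheses

/-! ### Weighted sums over the frequencies -/

section WeightSums

theorem bmax_nonneg (b : ℕ → ℕ → ℝ) (n : ℕ) : 0 ≤ bmax b n := NNReal.coe_nonneg _

theorem bnorm_nonneg (b : ℕ → ℕ → ℝ) (n : ℕ) : 0 ≤ bnorm b n := Real.sqrt_nonneg _

theorem abs_le_bmax (b : ℕ → ℕ → ℝ) {n j : ℕ} (hj : j ∈ Finset.Icc 1 (nu n)) :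
    |b n j| ≤ bmax b n := by
  have : ‖b n j‖₊ ≤ (Finset.Icc 1 (nu n)).sup fun j => ‖b n j‖₊ :=
    Finset.le_sup (f := fun j => ‖b n j‖₊) hj
  exact_mod_cast this

theorem bmax_le_bnorm (b : ℕ → ℕ → ℝ) (n : ℕ) : bmax b n ≤ bnorm b n := by
  have h : (Finset.Icc 1 (nu n)).sup (fun j => ‖b n j‖₊) ≤ (bnorm b n).toNNReal := by
    refine Finset.sup_le fun j hj => NNReal.le_toNNReal_of_coe_le ?_
    change |b n j| ≤ √(∑ j ∈ Finset.Icc 1 (nu n), (b n j) ^ 2)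
    refine Real.le_sqrt_of_sq_le ?_
    rw [sq_abs]
    exact Finset.single_le_sum (f := fun j => b n j ^ 2) (fun _ _ => sq_nonneg _) hj
  rw [← Real.coe_toNNReal _ (bnorm_nonneg b n)]
  exact_mod_cast h

/-- The involution `j ↦ n / 2 - j` preserves the index set, so the two kernel peaks contribute sums
of the same kind. -/
theorem sum_reflect (n : ℕ) (φ : ℕ → ℝ) :
    ∑ j ∈ Finset.Icc 1 (nu n), φ (n / 2 - j) = ∑ j ∈ Finset.Icc 1 (nu n), φ j := by
  refine Finset.sum_nbij' (fun j => n / 2 - j) (fun j => n / 2 - j) ?_ ?_ ?_ ?_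
    (fun _ _ => rfl) <;>
  · intro j hj
    simp only [Finset.mem_Icc, nu] at hj ⊢
    omega

theorem sum_one_div_le {n : ℕ} (hn : 4 ≤ n) :
    ∑ j ∈ Finset.Icc 1 (nu n), 1 / (j : ℝ) ≤ 1 + Real.log n := by
  have h1 := harmonic_le_one_add_log (nu n)
  rw [harmonic_eq_sum_Icc] at h1
  push_cast at h1
  simp only [one_div]
  refine h1.trans ?_
  have h2 : 0 < nu n := by unfold nu; omega
  have h3 : nu n ≤ n := by unfold nu; omega
  gcongr

/-- Mixed Hölder inequality between the maximum and the Euclidean norm of the weights. -/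
theorem sq_sum_weight_cube_le (b : ℕ → ℕ → ℝ) (n : ℕ) {q : ℕ → ℝ} {Q : ℝ}
    (hQ : ∑ j ∈ Finset.Icc 1 (nu n), q j ^ 4 ≤ Q) :
    (∑ j ∈ Finset.Icc 1 (nu n), |b n j| * q j ^ 3) ^ 2 ≤ Q * √Q * (bmax b n * bnorm b n) := by
  set T := Finset.Icc 1 (nu n) with hT
  have hs0 : 0 ≤ ∑ j ∈ T, q j ^ 4 := Finset.sum_nonneg fun j _ => by positivity
  have hQ0 : 0 ≤ Q := hs0.trans hQ
  have hB := bnorm_nonneg b n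
  have hb := bmax_nonneg b n
  -- Two applications of Cauchy–Schwarz: this one, and one for `|b| q³ = (|b| q) q²`. In between,
  -- one factor of `(|b| q)² = |b| (|b| q²)` is bounded by the maximum.
  have h1 : ∑ j ∈ T, |b n j| * q j ^ 2 ≤ bnorm b n * √Q := by
    have h2 := Real.sum_mul_le_sqrt_mul_sqrt T (fun j => |b n j|) (fun j => q j ^ 2)
    simp only [sq_abs, ← pow_mul] at h2
    exact h2.trans (mul_le_mul_of_nonneg_left (Real.sqrt_le_sqrt hQ) hB)
  have h2 : ∑ j ∈ T, (|b n j| * q j) ^ 2 ≤ bmax b n * (bnorm b n * √Q) := by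
    calc _ ≤ ∑ j ∈ T, bmax b n * (|b n j| * q j ^ 2) := by
          refine Finset.sum_le_sum fun j hj => ?_
          have h3 := abs_le_bmax b hj
          calc (|b n j| * q j) ^ 2 = |b n j| * (|b n j| * q j ^ 2) := by ring
            _ ≤ _ := mul_le_mul_of_nonneg_right h3 (by positivity)
      _ = bmax b n * ∑ j ∈ T, |b n j| * q j ^ 2 := by rw [Finset.mul_sum]
      _ ≤ _ := mul_le_mul_of_nonneg_left h1 hb
  calc (∑ j ∈ T, |b n j| * q j ^ 3) ^ 2 = (∑ j ∈ T, (|b n j| * q j) * q j ^ 2) ^ 2 := by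
        congr 1; exact Finset.sum_congr rfl fun j _ => by ring
    _ ≤ (∑ j ∈ T, (|b n j| * q j) ^ 2) * ∑ j ∈ T, (q j ^ 2) ^ 2 :=
        Finset.sum_mul_sq_le_sq_mul_sq _ _ _
    _ = (∑ j ∈ T, (|b n j| * q j) ^ 2) * ∑ j ∈ T, q j ^ 4 := by simp only [← pow_mul]
    _ ≤ (bmax b n * (bnorm b n * √Q)) * Q := mul_le_mul h2 hQ hs0 (by positivity)
    _ = _ := by ring

/-- The exponent `7/24` does two things: its triple `7/8` leaves `j^(1/8)` to absorb the logarithm,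
and its quadruple `7/6` exceeds `1`, so the fourth powers are summable. The constant is `9 = 1 + 8`.
-/
theorem one_add_log_div_le {j : ℕ} (hj : 1 ≤ j) :
    (1 + Real.log j) / j ≤ 9 * ((j : ℝ) ^ (-(7 / 24) : ℝ)) ^ 3 := by
  have hj1 : (1 : ℝ) ≤ j := by exact_mod_cast hj
  have hj0 : (0 : ℝ) < j := by linarith
  have h1 : Real.log j ≤ (j : ℝ) ^ (1 / 8 : ℝ) / (1 / 8) :=
    Real.log_le_rpow_div hj0.le (by norm_num)
  have h2 : (1 : ℝ) ≤ (j : ℝ) ^ (1 / 8 : ℝ) := Real.one_le_rpow hj1 (by norm_num)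
  have h3 : ((j : ℝ) ^ (-(7 / 24) : ℝ)) ^ 3 = (j : ℝ) ^ (1 / 8 : ℝ) / j := by
    rw [← Real.rpow_natCast, ← Real.rpow_mul hj0.le, ← Real.rpow_sub_one hj0.ne']
    norm_num
  rw [h3, ← mul_div_assoc]
  gcongr
  linarith

theorem exists_weight_sum_bound : ∃ C : ℝ, 1 ≤ C ∧ ∀ (b : ℕ → ℕ → ℝ) (n : ℕ),
    (∑ j ∈ Finset.Icc 1 (nu n), |b n j| * ((1 + Real.log j) / j + 1 / ((n / 2 - j : ℕ) : ℝ))) ^ 2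
      ≤ C * (bmax b n * bnorm b n) := by
  set q : ℕ → ℝ := fun j => (j : ℝ) ^ (-(7 / 24) : ℝ) with hq
  have hq4 : ∀ j, q j ^ 4 = (j : ℝ) ^ (-(7 / 6) : ℝ) := by
    intro j
    simp only [hq]
    rw [← Real.rpow_natCast, ← Real.rpow_mul (Nat.cast_nonneg j)]
    norm_num
  have hsummable : Summable fun j : ℕ => q j ^ 4 := by
    simp only [hq4]
    exact Real.summable_nat_rpow.2 (by norm_num)
  set Q := ∑' j, q j ^ 4 with hQdef
  have hQ : ∀ n, ∑ j ∈ Finset.Icc 1 (nu n), q j ^ 4 ≤ Q := fun n =>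
    hsummable.sum_le_tsum _ fun j _ => by positivity
  have hQ0 : 0 ≤ Q := tsum_nonneg fun j => by positivity
  -- `324 = 9² · 2 · 2`, from squaring `9 (s₁ + s₂)` and bounding each square. The `+ 1` makes the
  -- constant at least `1`, so that it is dominated by its square later.
  refine ⟨324 * (Q * √Q) + 1, by nlinarith [mul_nonneg hQ0 (Real.sqrt_nonneg Q)], fun b n => ?_⟩
  have hbB := mul_nonneg (bmax_nonneg b n) (bnorm_nonneg b n)
  set T := Finset.Icc 1 (nu n) with hT
  have h1 := sq_sum_weight_cube_le b n (hQ n)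
  have h2 := sq_sum_weight_cube_le b n (q := fun j => q (n / 2 - j)) (Q := Q)
    (by rw [sum_reflect n fun j => q j ^ 4]; exact hQ n)
  rw [← hT] at h1 h2
  set s₁ := ∑ j ∈ T, |b n j| * q j ^ 3
  set s₂ := ∑ j ∈ T, |b n j| * q (n / 2 - j) ^ 3
  have h3 : ∑ j ∈ T, |b n j| * ((1 + Real.log j) / j + 1 / ((n / 2 - j : ℕ) : ℝ))
      ≤ 9 * (s₁ + s₂) := by
    rw [← Finset.sum_add_distrib, Finset.mul_sum]
    refine Finset.sum_le_sum fun j hj => ?_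
    simp only [hT, Finset.mem_Icc, nu] at hj
    have h4 := one_add_log_div_le hj.1
    have h5 : 1 ≤ n / 2 - j := by omega
    have h6 := one_add_log_div_le h5
    have h7 : 1 / ((n / 2 - j : ℕ) : ℝ) ≤ (1 + Real.log ((n / 2 - j : ℕ) : ℝ)) /
        ((n / 2 - j : ℕ) : ℝ) := by
      gcongr
      have : 0 ≤ Real.log ((n / 2 - j : ℕ) : ℝ) := Real.log_natCast_nonneg _
      linarith
    calc _ ≤ |b n j| * (9 * q j ^ 3 + 9 * q (n / 2 - j) ^ 3) :=
          mul_le_mul_of_nonneg_left (add_le_add h4 (h7.trans h6)) (abs_nonneg _)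
      _ = _ := by ring
  have h0 : 0 ≤ ∑ j ∈ T, |b n j| * ((1 + Real.log j) / j + 1 / ((n / 2 - j : ℕ) : ℝ)) :=
    Finset.sum_nonneg fun j _ => by
      have := Real.log_natCast_nonneg j
      positivity
  calc _ ≤ (9 * (s₁ + s₂)) ^ 2 := pow_le_pow_left₀ h0 h3 2
    _ ≤ 162 * (s₁ ^ 2 + s₂ ^ 2) := by nlinarith [sq_nonneg (s₁ - s₂)]
    _ ≤ 162 * (Q * √Q * (bmax b n * bnorm b n) + Q * √Q * (bmax b n * bnorm b n)) := by linarith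
    _ ≤ _ := by linarith

theorem sum_log_weight_le {n : ℕ} (hn : 4 ≤ n) :
    1 ≤ Real.log n ∧
    ∑ j ∈ Finset.Icc 1 (nu n), (1 / (j : ℝ) + 1 / ((n / 2 - j : ℕ) : ℝ)) ≤ 4 * Real.log n ∧
    ∑ j ∈ Finset.Icc 1 (nu n), ((1 + Real.log j) / j + 1 / ((n / 2 - j : ℕ) : ℝ))
      ≤ 6 * Real.log n ^ 2 := by
  have hn4 : (4 : ℝ) ≤ n := by exact_mod_cast hn
  have hL : 1 ≤ Real.log n := by
    rw [Real.le_log_iff_exp_le (by linarith)]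
    linarith [Real.exp_one_lt_d9]
  have h1 := sum_one_div_le hn
  have h2 := sum_reflect n fun j => 1 / (j : ℝ)
  have h3 : ∑ j ∈ Finset.Icc 1 (nu n), (1 + Real.log j) / (j : ℝ)
      ≤ (1 + Real.log n) * (1 + Real.log n) := by
    calc _ ≤ ∑ j ∈ Finset.Icc 1 (nu n), (1 + Real.log n) * (1 / (j : ℝ)) := by
          refine Finset.sum_le_sum fun j hj => ?_
          simp only [Finset.mem_Icc, nu] at hj
          have hj1 : (0 : ℝ) < j := by exact_mod_cast hj.1
          have hjn : (j : ℝ) ≤ n := by exact_mod_cast (by omega : j ≤ n)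
          rw [mul_one_div]
          gcongr
      _ = (1 + Real.log n) * ∑ j ∈ Finset.Icc 1 (nu n), 1 / (j : ℝ) := by rw [Finset.mul_sum]
      _ ≤ _ := mul_le_mul_of_nonneg_left h1 (by linarith)
  refine ⟨hL, ?_, ?_⟩
  · rw [Finset.sum_add_distrib, h2]; linarith
  · rw [Finset.sum_add_distrib, h2]
    nlinarith

end WeightSums

/-! ### Estimates for the mean and the variance -/

section Estimates

theorem sqErr_nonneg (n j : ℕ) (G : ℝ → ℂ) : 0 ≤ sqErr n j G :=
  mul_nonneg (by positivity) (integral_nonneg fun u => by positivity)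

variable {Ω : Type*} [MeasurableSpace Ω] {P : Measure Ω} [IsProbabilityMeasure P]

set_option maxHeartbeats 1600000 in
/-- Bounds for the mean, the variance and the second moment of the approximation error. -/
theorem exists_R_estimates {a : ℕ → ℝ} {ζ X : ℤ → Ω → ℝ} {f : ℝ → ℝ} {A : ℝ → ℂ} {d m K₁ K₂ K₃ : ℝ}
    (hζ : StandardizedFourth P ζ m) (hX : IsLinearProcess P a ζ X) (hA : IsTransferFunction a A)
    (hd : |d| < 1 / 2) (hAf : ∀ u ∈ Set.Ioo 0 π, ‖A u‖ ^ 2 = 2 * π * f u)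
    (hK : TransferBounds A d K₁ K₂ K₃) :
    ∃ C : ℝ, 0 < C ∧ ∀ (b : ℕ → ℕ → ℝ) (n : ℕ),
      MemLp (R b f X ζ n) 2 P ∧
      ∫ ω, (R b f X ζ n ω - ∫ ω', R b f X ζ n ω' ∂P) ^ 2 ∂P ≤ C * bmax b n ^ 2 * Real.log n ^ 3 ∧
      ∫ ω, (R b f X ζ n ω - ∫ ω', R b f X ζ n ω' ∂P) ^ 2 ∂P ≤ C * bmax b n * bnorm b n ∧
      |∫ ω, R b f X ζ n ω ∂P| ≤ C * bmax b n * Real.log n ^ 2 ∧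
      (∫ ω, R b f X ζ n ω ∂P) ^ 2 ≤ C * bmax b n * bnorm b n := by
  obtain ⟨C₀, hC₀, herr⟩ := hK.exists_err_le hd
  obtain ⟨C₁, hC₁, hsum⟩ := exists_weight_sum_bound
  have hm : 0 ≤ m := le_trans (integral_nonneg fun ω => by positivity) (hζ.fourth 0)
  refine ⟨(m + 2) * (24 * C₀ + 48 * C₀ ^ 2) + (m + 2) * (6 * C₀ * C₁ + 3 * C₀ ^ 2 * C₁)
    + 18 * C₀ + 9 * C₀ ^ 2 * C₁, by positivity, fun b n => ?_⟩
  set D₁ := (m + 2) * (24 * C₀ + 48 * C₀ ^ 2) with hD₁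
  set D₂ := (m + 2) * (6 * C₀ * C₁ + 3 * C₀ ^ 2 * C₁) with hD₂
  have hD₁0 : 0 ≤ D₁ := by positivity
  have hD₂0 : 0 ≤ D₂ := by positivity
  have hD₃0 : 0 ≤ 18 * C₀ := by positivity
  have hD₄0 : 0 ≤ 9 * C₀ ^ 2 * C₁ := by positivity
  obtain ⟨hmem, hmean, hvar⟩ := hX.R_bound hζ hA (n := n)
    (fun j hj => hAf _ (freq_mem hj)) b
  have hb := bmax_nonneg b n
  have hB := bnorm_nonneg b n
  have hbB := bmax_le_bnorm b n
  have hsum' := hsum b n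
  set T := Finset.Icc 1 (nu n) with hT
  set s : ℕ → ℝ := fun j => sqErr n j fun u => A u / A (freq n j) - 1 with hs
  set σ : ℕ → ℝ := fun j => 1 / (j : ℝ) + 1 / ((n / 2 - j : ℕ) : ℝ) with hσ
  set τ : ℕ → ℝ := fun j => (1 + Real.log j) / j + 1 / ((n / 2 - j : ℕ) : ℝ) with hτ
  have hs0 : ∀ j, 0 ≤ s j := fun j => sqErr_nonneg _ _ _
  have hσ0 : ∀ j, 0 ≤ σ j := fun j => by simp only [hσ]; positivity
  have hστ : ∀ j, σ j ≤ τ j := fun j => by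
    simp only [hσ, hτ]
    have := Real.log_natCast_nonneg j
    gcongr
    linarith
  have hsσ : ∀ j ∈ T, s j ≤ C₀ * σ j := fun j hj => (herr n j hj).1
  set Wσ := ∑ j ∈ T, |b n j| * σ j with hWσ
  set Wτ := ∑ j ∈ T, |b n j| * τ j with hWτ
  have hWσ0 : 0 ≤ Wσ := Finset.sum_nonneg fun j _ => mul_nonneg (abs_nonneg _) (hσ0 j)
  have hWστ : Wσ ≤ Wτ :=
    Finset.sum_le_sum fun j _ => mul_le_mul_of_nonneg_left (hστ j) (abs_nonneg _)
  have hWs : ∑ j ∈ T, |b n j| * s j ≤ C₀ * Wσ := by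
    rw [hWσ, Finset.mul_sum]
    refine Finset.sum_le_sum fun j hj => ?_
    calc _ ≤ |b n j| * (C₀ * σ j) := mul_le_mul_of_nonneg_left (hsσ j hj) (abs_nonneg _)
      _ = _ := by ring
  have hWs0 : 0 ≤ ∑ j ∈ T, |b n j| * s j :=
    Finset.sum_nonneg fun j _ => mul_nonneg (abs_nonneg _) (hs0 j)
  have hWs2 : ∑ j ∈ T, b n j ^ 2 * s j ≤ bmax b n * (C₀ * Wσ) := by
    refine le_trans ?_ (mul_le_mul_of_nonneg_left hWs hb)
    rw [Finset.mul_sum]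
    refine Finset.sum_le_sum fun j hj => ?_
    rw [← sq_abs, sq, mul_assoc]
    exact mul_le_mul_of_nonneg_right (abs_le_bmax b hj) (mul_nonneg (abs_nonneg _) (hs0 j))
  have hvar' : ∫ ω, (R b f X ζ n ω - ∫ ω', R b f X ζ n ω' ∂P) ^ 2 ∂P
      ≤ (m + 2) * (6 * (bmax b n * (C₀ * Wσ)) + 3 * (C₀ * Wσ) ^ 2) := by
    refine hvar.trans (mul_le_mul_of_nonneg_left ?_ (by linarith))
    have := pow_le_pow_left₀ hWs0 hWs 2
    linarith
  have hmean' : |∫ ω, R b f X ζ n ω ∂P| ≤ 3 * C₀ * Wτ := by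
    rw [hmean, hWτ, Finset.mul_sum]
    refine (Finset.abs_sum_le_sum_abs _ _).trans (Finset.sum_le_sum fun j hj => ?_)
    rw [abs_mul]
    have h1 := (Complex.abs_re_le_norm _).trans (herr n j hj).2
    have h2 : |2 * (meanErr n j fun u => A u / A (freq n j) - 1).re + s j| ≤ 3 * C₀ * τ j := by
      refine (abs_add_le _ _).trans ?_
      rw [abs_mul, abs_two, abs_of_nonneg (hs0 j)]
      have h3 : s j ≤ C₀ * τ j :=
        (hsσ j hj).trans (mul_le_mul_of_nonneg_left (hστ j) hC₀.le)
      linarith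
    calc _ ≤ |b n j| * (3 * C₀ * τ j) := mul_le_mul_of_nonneg_left h2 (abs_nonneg _)
      _ = _ := by ring
  have hWτ0 : 0 ≤ Wτ := hWσ0.trans hWστ
  -- Uses `b_n ≤ B_n`. It treats the part of the variance that already carries a factor `b_n`, where
  -- a bound linear in `Wσ` is needed.
  have hWτB : Wτ ≤ C₁ * bnorm b n := by
    refine le_of_sq_le_sq ?_ (by positivity)
    calc Wτ ^ 2 ≤ C₁ * (bmax b n * bnorm b n) := hsum'
      _ ≤ C₁ * (bnorm b n * bnorm b n) := by gcongr
      _ ≤ C₁ ^ 2 * (bnorm b n * bnorm b n) := by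
          refine mul_le_mul_of_nonneg_right ?_ (by positivity)
          nlinarith
      _ = _ := by ring
  have hbBn : 0 ≤ bmax b n * bnorm b n := mul_nonneg hb hB
  refine ⟨hmem, ?_, ?_, ?_, ?_⟩
  · rcases lt_or_ge n 4 with hn | hn
    · have h0 : Wσ = 0 := by
        have : nu n = 0 := by unfold nu; omega
        simp [hWσ, hT, this]
      rw [h0] at hvar'
      refine hvar'.trans ?_
      have hL := Real.log_natCast_nonneg n
      have : (m + 2) * (6 * (bmax b n * (C₀ * 0)) + 3 * (C₀ * 0) ^ 2) = 0 := by ring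
      rw [this]
      positivity
    · obtain ⟨hL, hσL, -⟩ := sum_log_weight_le hn
      set L := Real.log n
      have hW : Wσ ≤ 4 * (bmax b n * L) := by
        calc Wσ ≤ ∑ j ∈ T, bmax b n * σ j := Finset.sum_le_sum fun j hj =>
              mul_le_mul_of_nonneg_right (abs_le_bmax b hj) (hσ0 j)
          _ = bmax b n * ∑ j ∈ T, σ j := by rw [Finset.mul_sum]
          _ ≤ bmax b n * (4 * L) := mul_le_mul_of_nonneg_left hσL hb
          _ = _ := by ring
      -- The variance estimate produces only `L` and `L²`; since `L ≥ 1`, both are relaxed to `L³`.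
      have hL1 : L ≤ L ^ 3 := by nlinarith [sq_nonneg (L - 1), sq_nonneg L]
      have hL2 : L ^ 2 ≤ L ^ 3 := by nlinarith [sq_nonneg L]
      calc _ ≤ (m + 2) * (6 * (bmax b n * (C₀ * (4 * (bmax b n * L))))
            + 3 * (C₀ * (4 * (bmax b n * L))) ^ 2) := hvar'.trans (by gcongr)
        _ = (m + 2) * (24 * C₀ * bmax b n ^ 2 * L + 48 * C₀ ^ 2 * bmax b n ^ 2 * L ^ 2) := by ring
        _ ≤ (m + 2) * (24 * C₀ * bmax b n ^ 2 * L ^ 3 + 48 * C₀ ^ 2 * bmax b n ^ 2 * L ^ 3) := by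
            gcongr
        _ = D₁ * (bmax b n ^ 2 * L ^ 3) := by rw [hD₁]; ring
        _ ≤ (D₁ + D₂ + 18 * C₀ + 9 * C₀ ^ 2 * C₁) * (bmax b n ^ 2 * L ^ 3) :=
            mul_le_mul_of_nonneg_right (by linarith) (by positivity)
        _ = _ := by ring
  · have h1 : Wσ ^ 2 ≤ C₁ * (bmax b n * bnorm b n) :=
      (pow_le_pow_left₀ hWσ0 hWστ 2).trans hsum'
    calc _ ≤ (m + 2) * (6 * (bmax b n * (C₀ * (C₁ * bnorm b n)))
            + 3 * (C₀ ^ 2 * (C₁ * (bmax b n * bnorm b n)))) := by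
          refine hvar'.trans (mul_le_mul_of_nonneg_left ?_ (by linarith))
          rw [mul_pow]
          have h2 := hWστ.trans hWτB
          gcongr
      _ = D₂ * (bmax b n * bnorm b n) := by rw [hD₂]; ring
      _ ≤ (D₁ + D₂ + 18 * C₀ + 9 * C₀ ^ 2 * C₁) * (bmax b n * bnorm b n) :=
          mul_le_mul_of_nonneg_right (by linarith) hbBn
      _ = _ := by ring
  · rcases lt_or_ge n 4 with hn | hn
    · have h0 : Wτ = 0 := by
        have : nu n = 0 := by unfold nu; omega
        simp [hWτ, hT, this]
      rw [h0, mul_zero] at hmean'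
      refine hmean'.trans ?_
      positivity
    · obtain ⟨hL, -, hτL⟩ := sum_log_weight_le hn
      set L := Real.log n
      calc _ ≤ 3 * C₀ * ∑ j ∈ T, bmax b n * τ j := hmean'.trans
            (mul_le_mul_of_nonneg_left (Finset.sum_le_sum fun j hj =>
              mul_le_mul_of_nonneg_right (abs_le_bmax b hj) ((hσ0 j).trans (hστ j)))
              (by positivity))
        _ = 3 * C₀ * (bmax b n * ∑ j ∈ T, τ j) := by rw [← Finset.mul_sum]
        _ ≤ 3 * C₀ * (bmax b n * (6 * L ^ 2)) := by gcongr
        _ = 18 * C₀ * (bmax b n * L ^ 2) := by ring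
        _ ≤ (D₁ + D₂ + 18 * C₀ + 9 * C₀ ^ 2 * C₁) * (bmax b n * L ^ 2) :=
            mul_le_mul_of_nonneg_right (by linarith) (by positivity)
        _ = _ := by ring
  · calc (∫ ω, R b f X ζ n ω ∂P) ^ 2 = |∫ ω, R b f X ζ n ω ∂P| ^ 2 := (sq_abs _).symm
      _ ≤ (3 * C₀ * Wτ) ^ 2 := pow_le_pow_left₀ (abs_nonneg _) hmean' 2
      _ = 9 * C₀ ^ 2 * Wτ ^ 2 := by ring
      _ ≤ 9 * C₀ ^ 2 * (C₁ * (bmax b n * bnorm b n)) :=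
          mul_le_mul_of_nonneg_left hsum' (by positivity)
      _ = 9 * C₀ ^ 2 * C₁ * (bmax b n * bnorm b n) := by ring
      _ ≤ (D₁ + D₂ + 18 * C₀ + 9 * C₀ ^ 2 * C₁) * (bmax b n * bnorm b n) :=
          mul_le_mul_of_nonneg_right (by linarith) hbBn
      _ = _ := by ring

theorem integral_sq_eq_variance_add {Y : Ω → ℝ} (hY : MemLp Y 2 P) :
    ∫ ω, Y ω ^ 2 ∂P = ∫ ω, (Y ω - ∫ ω', Y ω' ∂P) ^ 2 ∂P + (∫ ω, Y ω ∂P) ^ 2 := by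
  have h1 := variance_eq_integral hY.aestronglyMeasurable.aemeasurable
  have h2 := variance_eq_sub hY
  simp only [Pi.pow_apply] at h2
  linarith

theorem bmax_eq_zero {n : ℕ} (hn : n < 4) (b : ℕ → ℕ → ℝ) : bmax b n = 0 := by
  have : nu n = 0 := by unfold nu; omega
  simp [bmax, this]

end Estimates

end Bartlett

/-! ### The main theorem -/

theorem lemma2p1 {Ω : Type*} [MeasurableSpace Ω] (P : Measure Ω) [IsProbabilityMeasure P]
    (a : ℕ → ℝ) (ζ X : ℤ → Ω → ℝ) (f : ℝ → ℝ) (A : ℝ → ℂ) (d : ℝ)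
    (hζ : Bartlett.IsIIDStandardized P ζ)
    (hζ4 : Integrable (fun ω => (ζ 0 ω) ^ 4) P)
    (hX : Bartlett.IsLinearProcess P a ζ X)
    (hf : Bartlett.IsSpectralDensity P X f)
    (hA : Bartlett.IsTransferFunction a A)
    (hd : |d| < 1 / 2)
    (hfd : Bartlett.SpectralCondition f d)
    (hAd : Bartlett.TransferCondition A d) :
    ∃ C : ℝ, 0 < C ∧ ∀ b : ℕ → ℕ → ℝ,
      (∀ n : ℕ,
        MemLp (Bartlett.R b f X ζ n) 2 P ∧
        ∫ ω, (Bartlett.R b f X ζ n ω - ∫ ω', Bartlett.R b f X ζ n ω' ∂P) ^ 2 ∂P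
          ≤ C * (Bartlett.bmax b n) ^ 2 * (Real.log n) ^ 3 ∧
        ∫ ω, (Bartlett.R b f X ζ n ω - ∫ ω', Bartlett.R b f X ζ n ω' ∂P) ^ 2 ∂P
          ≤ C * Bartlett.bmax b n * Bartlett.bnorm b n ∧
        |∫ ω, Bartlett.R b f X ζ n ω ∂P| ≤ C * Bartlett.bmax b n * (Real.log n) ^ 2 ∧
        ∫ ω, (Bartlett.SX b f X n ω - Bartlett.Sζ b ζ n ω) ^ 2 ∂P
          ≤ C * (Bartlett.bmax b n) ^ 2 * (Real.log n) ^ 4) ∧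
      ((Bartlett.bmax b) =o[atTop] (Bartlett.bnorm b) →
        (fun n => ∫ ω, Bartlett.R b f X ζ n ω ∂P) =o[atTop] (Bartlett.bnorm b) ∧
        (fun n => ∫ ω, (Bartlett.SX b f X n ω - Bartlett.Sζ b ζ n ω) ^ 2 ∂P)
          =o[atTop] (fun n => (Bartlett.bnorm b n) ^ 2)) := by
  have hS := hζ.standardizedFourth hζ4
  obtain ⟨hAf, K₁, K₂, K₃, hK⟩ := Bartlett.exists_transferBounds
    (Bartlett.ae_norm_sq_transfer_eq hS hX hf hA) hfd hAd
  obtain ⟨C, hC, hest⟩ := Bartlett.exists_R_estimates hS hX hA hd hAf hK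
  -- In the second moment, `C` accounts for the variance and `C²` for the square of the mean.
  refine ⟨C + C ^ 2, by positivity, fun b => ⟨fun n => ?_, fun ho => ?_⟩⟩
  · obtain ⟨h1, h2, h3, h4, -⟩ := hest b n
    have hb := Bartlett.bmax_nonneg b n
    have hB := Bartlett.bnorm_nonneg b n
    have hL := Real.log_natCast_nonneg n
    have hCC : C ≤ C + C ^ 2 := by nlinarith
    refine ⟨h1, h2.trans (by gcongr), h3.trans (by gcongr), h4.trans (by gcongr), ?_⟩
    change ∫ ω, Bartlett.R b f X ζ n ω ^ 2 ∂P ≤ _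
    rw [Bartlett.integral_sq_eq_variance_add h1]
    have h5 : (∫ ω, Bartlett.R b f X ζ n ω ∂P) ^ 2
        ≤ (C * Bartlett.bmax b n * (Real.log n) ^ 2) ^ 2 := by
      rw [← sq_abs]
      exact pow_le_pow_left₀ (abs_nonneg _) h4 2
    have h6 : C * Bartlett.bmax b n ^ 2 * Real.log n ^ 3
        ≤ C * Bartlett.bmax b n ^ 2 * Real.log n ^ 4 := by
      -- Raising the power of `log n` needs `log n ≥ 1`, which may fail for small `n`; there the
      -- weights are empty and `bmax` is zero.
      rcases lt_or_ge n 4 with hn | hn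
      · simp [Bartlett.bmax_eq_zero hn]
      · have hL1 := (Bartlett.sum_log_weight_le hn).1
        gcongr
        norm_num
    calc _ ≤ C * Bartlett.bmax b n ^ 2 * Real.log n ^ 4
          + (C * Bartlett.bmax b n * (Real.log n) ^ 2) ^ 2 := add_le_add (h2.trans h6) h5
      _ = _ := by ring
  -- Variance and squared mean are both at most `C b_n B_n`, which is `o(B_n²)` when `b_n = o(B_n)`;
  -- both little-o claims reduce to this.
  · have hsmall : ∀ c : ℝ, 0 < c → ∀ᶠ n in atTop,
        C * Bartlett.bmax b n * Bartlett.bnorm b n ≤ c * Bartlett.bnorm b n ^ 2 := by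
      intro c hc
      filter_upwards [isLittleO_iff.1 ho (by positivity : 0 < c / C)] with n hn
      have hB := Bartlett.bnorm_nonneg b n
      rw [Real.norm_of_nonneg (Bartlett.bmax_nonneg b n), Real.norm_of_nonneg hB] at hn
      calc C * Bartlett.bmax b n * Bartlett.bnorm b n
          ≤ C * (c / C * Bartlett.bnorm b n) * Bartlett.bnorm b n := by gcongr
        _ = _ := by field_simp
    constructor
    · refine isLittleO_iff.2 fun c hc => ?_
      filter_upwards [hsmall (c ^ 2) (by positivity)] with n hn
      have hB := Bartlett.bnorm_nonneg b n
      rw [Real.norm_eq_abs, Real.norm_of_nonneg hB]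
      refine abs_le_of_sq_le_sq ?_ (by positivity)
      rw [mul_pow]
      exact (hest b n).2.2.2.2.trans hn
    · refine isLittleO_iff.2 fun c hc => ?_
      filter_upwards [hsmall (c / 2) (by positivity)] with n hn
      obtain ⟨h1, -, h3, -, h5⟩ := hest b n
      change ‖∫ ω, Bartlett.R b f X ζ n ω ^ 2 ∂P‖ ≤ _
      rw [Real.norm_of_nonneg (integral_nonneg fun ω => sq_nonneg _),
        Real.norm_of_nonneg (sq_nonneg _), Bartlett.integral_sq_eq_variance_add h1]
      linarith
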